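/- Graphs are finite; loops and multiple edges are allowed. For a connected graph $G$, let $\gamma_i(G)$ be the number of cellular embeddings of $G$ in the orientable surface of genus $i$ (counted by rotation systems), and put $\gamma_{\min}(G)=\min\{i:\gamma_i(G)>0\}$, $\gamma_{\max}(G)=\max\{i:\gamma_i(G)>0\}$. The genus law $\gamma_G$ of $G$ is the genus of a uniformly random cellular embedding of $G$ in an orientable surface; the Euler-genus law $\varepsilon_G$ is the Euler-genus $2-(v-e+f)$ of a uniformly random cellular embedding of $G$ in a closed surface, orientable or not (equivalently, of a uniformly random signed rotation system of $G$). For a sequence $(H_n)_{n\ge1}$ of connected graphs, the genus (resp. Euler-genus) distributions of $(H_n)$ are called asymptotically normal if, with $X_n=\gamma_{H_n}$ (resp. $X_n=\varepsilon_{H_n}$), the cumulative distribution function of $(X_n-\mathbb{E}X_n)/\sqrt{\operatorname{Var}X_n}$ converges pointwise to that of $\mathcal N(0,1)$ as $n\to\infty$. **Theorem.** Let $(G_i)_{i\ge1}$ be a sequence of graphs, each with two distinct marked pendant vertices (vertices of degree $1$) $u_i,v_i$. For $n\ge1$ let $G_n^\circ$ be the bar-ring of $G_1,\dots,G_n$,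 that is, the graph obtained from the disjoint union of $G_1,\dots,G_n$ by adding, for each $1\le i\le n$, an edge between $v_i$ and $u_j$, where $1\le j\le n$ and $j\equiv i+1\pmod n$. Suppose that 1. every $G_i$ is connected, and $\gamma_{\max}(G_i)>\gamma_{\min}(G_i)$ for infinitely many $i$; 2. there is a constant $M$ such that every $G_i$ has at most $M$ edges. Then both the genus distributions and the Euler-genus distributions of $(G_n^\circ)_{n\ge1}$ are asymptotically normal. -/

import Mathlib

open MeasureTheory ProbabilityTheory

/-- A graph with vertex set `V` and edge set `E`, with loops and multiple edges allowed:
every edge `e` has the two (possibly equal) ends `ends e false` and `ends e true`. -/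
structure Multigraph (V : Type*) (E : Type*) where
  ends : E → Bool → V

namespace Multigraph

variable {V E : Type*}

/-- The vertex of a dart. A dart is an end `(e, b)` of an edge `e`; a loop has two darts. -/
def vert (G : Multigraph V E) (d : E × Bool) : V := G.ends d.1 d.2

/-- The permutation of the darts that exchanges the two darts of every edge. -/
def flip (E : Type*) : Equiv.Perm (E × Bool) := (Equiv.refl E).prodCongr Equiv.boolNot

/-- The degree of a vertex: the number of darts at it (a loop counts twice). -/
noncomputable def degree (G : Multigraph V E) (v : V) : ℕ :=
  Nat.card {d : E × Bool // G.vert d = v}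

/-- A pendant vertex is a vertex of degree one. -/
def IsPendant (G : Multigraph V E) (v : V) : Prop := G.degree v = 1

/-- The number of vertices without darts. -/
noncomputable def isolatedCount (G : Multigraph V E) : ℕ :=
  Nat.card {v : V // ∀ d : E × Bool, G.vert d ≠ v}

/-- The graph is connected (loops and multiplicities do not matter for this). -/
def Connected (G : Multigraph V E) : Prop :=
  (SimpleGraph.fromRel fun a b : V => ∃ e : E, G.ends e false = a ∧ G.ends e true = b).Connected

/-- A rotation system: a permutation of the darts with exactly one cycle at each (non-isolated)
vertex, consisting of all the darts at that vertex. Rotation systems are the cellular embeddings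
of a connected graph in oriented surfaces. -/
structure RotationSystem (G : Multigraph V E) where
  rot : Equiv.Perm (E × Bool)
  sameCycle_iff : ∀ d d' : E × Bool, rot.SameCycle d d' ↔ G.vert d = G.vert d'

/-- A signed rotation system: a rotation system together with a set of twisted edges. Signed
rotation systems describe the cellular embeddings of a connected graph in all closed surfaces.
Two of them describe the same embedding when they differ by reversing the rotation at some vertices
other than a fixed root and toggling the twist of the edges with exactly one end among
those vertices; so an embedding of a connected graph with `v` vertices is described by
exactly `2 ^ (v - 1)` signed rotation systems. -/
structure SignedRotationSystem (G : Multigraph V E) extends RotationSystem G where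
  twist : E → Bool

namespace RotationSystem

variable {G : Multigraph V E}

instance : MeasurableSpace (RotationSystem G) := ⊤

/-- The number of faces: the number of cycles of the product of the rotation and the edge
involution (an isolated vertex in a sphere has one face). -/
noncomputable def faceCount (ρ : RotationSystem G) : ℕ :=
  Nat.card (Quotient (Equiv.Perm.SameCycle.setoid (ρ.rot * flip E))) + G.isolatedCount

/-- The Euler-genus `2 - (v - e + f)`. -/
noncomputable def eulerGenus (ρ : RotationSystem G) : ℤ :=
  2 - ((Nat.card V : ℤ) - (Nat.card E : ℤ) + (ρ.faceCount : ℤ))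

/-- The genus of the orientable surface, half of the Euler-genus, as a real number. -/
noncomputable def genus (ρ : RotationSystem G) : ℝ := (ρ.eulerGenus : ℝ) / 2

end RotationSystem

namespace SignedRotationSystem

variable {G : Multigraph V E}

instance : MeasurableSpace (SignedRotationSystem G) := ⊤

/-- Every dart `d` has two sides: `(d, true)`, facing the next dart in the rotation, and
`(d, false)`, facing the previous one. `Adjacent` says when two sides follow each other on the
boundary of a face: across a corner at a vertex, or along an edge. An untwisted edge joins opposite
sides of its two darts, a twisted edge joins equal sides. -/
inductive Adjacent (ρ : SignedRotationSystem G) :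
    (E × Bool) × Bool → (E × Bool) × Bool → Prop
  | corner (d : E × Bool) : Adjacent ρ (d, true) (ρ.rot d, false)
  | edge (d : E × Bool) (s : Bool) : Adjacent ρ (d, s) (flip E d, (!s) ^^ ρ.twist d.1)

/-- The number of faces: the number of classes of the equivalence relation generated by
adjacency of sides, that is, the number of closed boundary walks
(an isolated vertex in a sphere has one face). -/
noncomputable def faceCount (ρ : SignedRotationSystem G) : ℕ :=
  Nat.card (Quot ρ.Adjacent) + G.isolatedCount

/-- The Euler-genus `2 - (v - e + f)`. -/
noncomputable def eulerGenus (ρ : SignedRotationSystem G) : ℤ :=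
  2 - ((Nat.card V : ℤ) - (Nat.card E : ℤ) + (ρ.faceCount : ℤ))

end SignedRotationSystem

/-- `γ_i(G)`, the number of embeddings of `G` in the orientable surface of genus `i`. -/
noncomputable def genusDistribution (G : Multigraph V E) (i : ℕ) : ℕ :=
  Nat.card {ρ : RotationSystem G // ρ.eulerGenus = 2 * (i : ℤ)}

/-- The minimum genus. -/
noncomputable def minGenus (G : Multigraph V E) : ℕ := sInf {i | 0 < G.genusDistribution i}

/-- The maximum genus. -/
noncomputable def maxGenus (G : Multigraph V E) : ℕ := sSup {i | 0 < G.genusDistribution i}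

/-- The bar-ring of `G 0, …, G (n - 1)` with marked vertices `u i`, `v i`: the disjoint union
together with, for each `i`, an edge from `v i` to `u j`, where `j = i + 1` modulo `n`. -/
def barRing {V E : ℕ → Type*} (G : ∀ i, Multigraph (V i) (E i)) (u v : ∀ i, V i) (n : ℕ) :
    Multigraph (Σ i : Fin n, V i) ((Σ i : Fin n, E i) ⊕ Fin n) where
  ends
    | Sum.inl ⟨i, e⟩, b => ⟨i, (G i).ends e b⟩
    | Sum.inr i, false => ⟨i, v i⟩
    | Sum.inr i, true => ⟨finRotate n i, u (finRotate n i)⟩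

end Multigraph

/-- A sequence of real random variables `X n`, each on its own probability space, is asymptotically
normal if the cumulative distribution functions of `(X n - 𝔼 X n) / √(Var X n)` converge pointwise
to that of the standard normal law. -/
def AsymptoticallyNormal {Ω : ℕ → Type*} [∀ n, MeasurableSpace (Ω n)]
    (P : ∀ n, Measure (Ω n)) (X : ∀ n, Ω n → ℝ) : Prop :=
  ∀ x : ℝ, Filter.Tendsto
    (fun n => (P n).real {ω | (X n ω - ∫ ω', X n ω' ∂(P n)) / √(variance (X n) (P n)) ≤ x})
    Filter.atTop (nhds ((gaussianReal 0 1).real (Set.Iic x)))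

namespace Multigraph

/-- The genus distributions of a sequence of graphs are asymptotically normal: the genus of
a uniformly random rotation system is. -/
def GenusAsymptoticallyNormal {V E : ℕ → Type*} (G : ∀ n, Multigraph (V n) (E n)) : Prop :=
  AsymptoticallyNormal (fun n => uniformOn (Set.univ : Set (RotationSystem (G n))))
    (fun _ ρ => ρ.genus)

/-- The Euler-genus distributions of a sequence of graphs are asymptotically normal: the
Euler-genus of a uniformly random signed rotation system is. Since all embeddings of
a connected graph are described by equally many signed rotation systems, this is
the Euler-genus of a uniformly random embedding. -/
def EulerGenusAsymptoticallyNormal {V E : ℕ → Type*} (G : ∀ n, Multigraph (V n) (E n)) : Prop :=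
  AsymptoticallyNormal (fun n => uniformOn (Set.univ : Set (SignedRotationSystem (G n))))
    (fun _ ρ => (ρ.eulerGenus : ℝ))

end Multigraph

/-!
Bar-rings of small graphs have asymptotically normal genus because the number of faces of an
embedding of the ring is a sum of independent contributions of the parts, up to an error of at
most one.

An embedding of the bar-ring is the same as a family of embeddings of the parts (with a free
choice of the twist of each edge of the ring): the marked vertices get degree two, where there is
only one rotation (`EndDarts.ringEquiv`, `EndDarts.signedRingEquiv`). To count faces, view the
ring as built from the disjoint union of its `N` parts and of `N` single edges by `2 * N`
junctions, each of which identifies two vertices of degree one. The boundary walks are the classes generated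
by two involutions of the sides of the darts, one crossing edges and one crossing corners. A
junction is a switch of two links of the second involution: it merges the two classes involved if
they are different (`faceNum_swap_mul_of_not_eqvGen`), and in any case it changes the number of
classes by at most one (`abs_faceNum_swap_mul_sub_le`). The merging rests on a parity argument:
the cycle formed by a class stays connected when one link is removed (`apply_mem_of_involutions`).
Going around the ring, all junctions but the last one join different components, so the number of
faces of the ring is the sum of those of the parts, minus `N - 1`, up to an error of at most one
(`EndDarts.abs_faceNum_joinPerm_mul_sub_le`).

For a uniformly random embedding of the ring the embeddings of the parts are independent and
uniform. Their face numbers are bounded, since the parts have at most `M` edges. Where the minimum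
genus is less than the maximum genus, the variance is bounded below, since it is that of a
non-constant integer-valued variable on a uniform space of bounded size; this happens infinitely
often, so the variance of the sum tends to infinity, and a central limit theorem for bounded
independent variables with bounded error terms applies (`asymptoticallyNormal_sum_add_bounded`).
It is proved with characteristic functions and Lévy's convergence theorem. Untwisted rotation
systems are signed rotation systems without twists, with the same faces
(`RotationSystem.faceCount_eq`), so one count of faces serves both for the genus and for the
Euler-genus.
-/

/-! ### A central limit theorem for bounded independent variables -/

lemma norm_prod_sub_prod_le {ι : Type*} (s : Finset ι) (a b : ι → ℂ)
    (ha : ∀ i ∈ s, ‖a i‖ ≤ 1) (hb : ∀ i ∈ s, ‖b i‖ ≤ 1) :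
    ‖∏ i ∈ s, a i - ∏ i ∈ s, b i‖ ≤ ∑ i ∈ s, ‖a i - b i‖ := by
  classical
  induction s using Finset.induction_on with
  | empty => simp
  | insert j s hj ih =>
    rw [Finset.prod_insert hj, Finset.prod_insert hj, Finset.sum_insert hj]
    have h1 : ‖∏ i ∈ s, a i‖ ≤ 1 := by
      rw [norm_prod]
      exact Finset.prod_le_one (fun _ _ => norm_nonneg _)
        fun i hi => ha i (Finset.mem_insert_of_mem hi)
    have h2 := ih (fun i hi => ha i (Finset.mem_insert_of_mem hi))
      (fun i hi => hb i (Finset.mem_insert_of_mem hi))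
    have h3 := hb j (Finset.mem_insert_self _ _)
    calc ‖a j * ∏ i ∈ s, a i - b j * ∏ i ∈ s, b i‖
        = ‖(a j - b j) * ∏ i ∈ s, a i + b j * (∏ i ∈ s, a i - ∏ i ∈ s, b i)‖ := by
          congr 1; ring
      _ ≤ ‖a j - b j‖ * ‖∏ i ∈ s, a i‖ + ‖b j‖ * ‖∏ i ∈ s, a i - ∏ i ∈ s, b i‖ := by
          rw [← norm_mul, ← norm_mul]; exact norm_add_le _ _
      _ ≤ ‖a j - b j‖ * 1 + 1 * ∑ i ∈ s, ‖a i - b i‖ := by gcongr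
      _ = _ := by ring

lemma norm_cexp_mul_I_sub_taylor_le {y : ℝ} (hy : |y| ≤ 1) :
    ‖Complex.exp (y * Complex.I) - (1 + y * Complex.I - y ^ 2 / 2)‖ ≤ |y| ^ 3 := by
  have hn : ‖(y * Complex.I : ℂ)‖ = |y| := by simp
  have h := Complex.exp_bound (x := y * Complex.I) (by rwa [hn]) (n := 3) (by norm_num)
  rw [hn] at h
  have hs : ∑ m ∈ Finset.range 3, (y * Complex.I : ℂ) ^ m / m.factorial =
      1 + y * Complex.I - y ^ 2 / 2 := by
    simp [Finset.sum_range_succ, Nat.factorial, mul_pow, Complex.I_sq]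
    ring
  rw [hs] at h
  refine h.trans ?_
  have : 0 ≤ |y| ^ 3 := by positivity
  norm_num [Nat.factorial]
  nlinarith

section Variables

variable {Ω : Type*} [MeasurableSpace Ω] {P : Measure Ω}

lemma charFun_map_real {X : Ω → ℝ} (hX : Measurable X) (t : ℝ) :
    charFun (P.map X) t = ∫ ω, Complex.exp ((t * X ω : ℝ) * Complex.I) ∂P := by
  rw [charFun_apply_real, integral_map hX.aemeasurable
    (Measurable.aestronglyMeasurable (by fun_prop))]
  simp

variable [IsProbabilityMeasure P]

lemma integrable_cexp_mul_I {X : Ω → ℝ} (hX : Measurable X) :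
    Integrable (fun ω => Complex.exp ((X ω : ℝ) * Complex.I)) P := by
  refine Integrable.of_bound (Measurable.aestronglyMeasurable (by fun_prop)) 1
    (Filter.Eventually.of_forall fun ω => ?_)
  rw [Complex.norm_exp_ofReal_mul_I]

/-- The characteristic function depends on the variable in a Lipschitz way, with respect to
the `L¹` distance. -/
lemma norm_charFun_map_sub_le {X Y : Ω → ℝ} (hX : Measurable X) (hY : Measurable Y)
    (hXY : Integrable (fun ω => X ω - Y ω) P) (t : ℝ) :
    ‖charFun (P.map X) t - charFun (P.map Y) t‖ ≤ |t| * ∫ ω, |X ω - Y ω| ∂P := by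
  rw [charFun_map_real hX, charFun_map_real hY,
    ← integral_sub (integrable_cexp_mul_I (by fun_prop)) (integrable_cexp_mul_I (by fun_prop)),
    ← integral_const_mul]
  refine norm_integral_le_of_norm_le (hXY.abs.const_mul _)
    (Filter.Eventually.of_forall fun ω => ?_)
  have h : Complex.exp ((t * X ω : ℝ) * Complex.I) - Complex.exp ((t * Y ω : ℝ) * Complex.I) =
      Complex.exp ((t * Y ω : ℝ) * Complex.I) *
        (Complex.exp (Complex.I * (t * (X ω - Y ω) : ℝ)) - 1) := by
    rw [mul_sub, ← Complex.exp_add, mul_one]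
    congr 2
    push_cast; ring
  rw [h, norm_mul, Complex.norm_exp_ofReal_mul_I, one_mul, ← abs_mul]
  exact Real.norm_exp_I_mul_ofReal_sub_one_le

/-- Second-order expansion of the characteristic function of a bounded centred variable,
written as a comparison with the characteristic function of the normal law of the same variance. -/
lemma norm_charFun_map_sub_gaussian_le {Z : Ω → ℝ} (hZ : Measurable Z) {B : ℝ}
    (hB : ∀ ω, |Z ω| ≤ B) (h0 : ∫ ω, Z ω ∂P = 0) {t : ℝ} (ht : B * |t| ≤ 1) :
    ‖charFun (P.map Z) t - Complex.exp ((-(t ^ 2 * variance Z P / 2) : ℝ))‖ ≤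
      2 * (B * |t| ^ 3 * variance Z P) := by
  have hB0 : 0 ≤ B := by
    obtain ⟨ω⟩ : Nonempty Ω := nonempty_of_isProbabilityMeasure P
    exact (abs_nonneg _).trans (hB ω)
  set V := variance Z P with hV
  have hVeq : V = ∫ ω, Z ω ^ 2 ∂P := variance_of_integral_eq_zero hZ.aemeasurable h0
  have hV0 : 0 ≤ V := variance_nonneg _ _
  have hsq : ∀ ω, Z ω ^ 2 ≤ B ^ 2 := fun ω => sq_le_sq' (abs_le.1 (hB ω)).1 (abs_le.1 (hB ω)).2
  have hint : Integrable Z P := Integrable.of_bound hZ.aestronglyMeasurable B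
    (Filter.Eventually.of_forall hB)
  have hint2 : Integrable (fun ω => Z ω ^ 2) P :=
    Integrable.of_bound (hZ.pow_const 2).aestronglyMeasurable (B ^ 2)
      (Filter.Eventually.of_forall fun ω => by
        rw [Real.norm_eq_abs, abs_of_nonneg (sq_nonneg _)]; exact hsq ω)
  have hVB : V ≤ B ^ 2 := by
    rw [hVeq]
    calc ∫ ω, Z ω ^ 2 ∂P ≤ ∫ _, B ^ 2 ∂P := integral_mono hint2 (integrable_const _) hsq
      _ = B ^ 2 := by simp
  have h1 : ‖charFun (P.map Z) t - (1 - t ^ 2 * V / 2 : ℝ)‖ ≤ B * |t| ^ 3 * V := by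
    have hmain : charFun (P.map Z) t - (1 - t ^ 2 * V / 2 : ℝ) =
        ∫ ω, (Complex.exp ((t * Z ω : ℝ) * Complex.I) -
          (1 + (t * Z ω : ℝ) * Complex.I - (t * Z ω : ℝ) ^ 2 / 2)) ∂P := by
      have hiC : Integrable (fun ω => ((t * Z ω : ℝ) : ℂ) * Complex.I) P :=
        ((hint.const_mul t).ofReal).mul_const _
      have hiC2 : Integrable (fun ω => ((t * Z ω : ℝ) : ℂ) ^ 2 / 2) P := by
        have : Integrable (fun ω => (((t * Z ω) ^ 2 / 2 : ℝ) : ℂ)) P := by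
          refine Integrable.ofReal ?_
          simp_rw [mul_pow]
          exact (hint2.const_mul _).div_const _
        simpa using this
      have hexp : Integrable (fun ω => Complex.exp ((t * Z ω : ℝ) * Complex.I)) P :=
        integrable_cexp_mul_I (by fun_prop)
      have hlin : Integrable (fun ω => 1 + ((t * Z ω : ℝ) : ℂ) * Complex.I) P :=
        (integrable_const _).add hiC
      have hquad : Integrable (fun ω => 1 + ((t * Z ω : ℝ) : ℂ) * Complex.I -
          ((t * Z ω : ℝ) : ℂ) ^ 2 / 2) P := hlin.sub hiC2
      rw [integral_sub hexp hquad, integral_sub hlin hiC2,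
        integral_add (integrable_const _) hiC, charFun_map_real hZ, integral_mul_const,
        integral_complex_ofReal, integral_const_mul, h0]
      have : ∫ ω, ((t * Z ω : ℝ) : ℂ) ^ 2 / 2 ∂P = ((t ^ 2 * V / 2 : ℝ) : ℂ) := by
        rw [hVeq, ← integral_const_mul, ← integral_div, ← integral_complex_ofReal]
        congr 1; ext ω; push_cast; ring
      rw [this]
      simp
    rw [hmain]
    have : B * |t| ^ 3 * V = ∫ ω, B * |t| ^ 3 * Z ω ^ 2 ∂P := by
      rw [integral_const_mul, hVeq]
    rw [this]
    refine norm_integral_le_of_norm_le (hint2.const_mul _)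
      (Filter.Eventually.of_forall fun ω => ?_)
    have hy : |t * Z ω| ≤ 1 := by
      rw [abs_mul]
      calc |t| * |Z ω| ≤ |t| * B := by gcongr; exact hB ω
        _ ≤ 1 := by linarith
    refine (norm_cexp_mul_I_sub_taylor_le hy).trans ?_
    calc |t * Z ω| ^ 3 = |t| ^ 3 * (|Z ω| * Z ω ^ 2) := by
          rw [abs_mul, mul_pow, ← sq_abs (Z ω)]; ring
      _ ≤ |t| ^ 3 * (B * Z ω ^ 2) := by gcongr; exact hB ω
      _ = B * |t| ^ 3 * Z ω ^ 2 := by ring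
  have hw0 : 0 ≤ t ^ 2 * V / 2 := by positivity
  have hBt : (B * |t|) ^ 2 ≤ 1 := pow_le_one₀ (by positivity) ht
  have htV : t ^ 2 * V ≤ (B * |t|) ^ 2 := by
    rw [mul_pow, sq_abs]; nlinarith [sq_nonneg t]
  have h2 : ‖((1 - t ^ 2 * V / 2 : ℝ) : ℂ) - Complex.exp ((-(t ^ 2 * V / 2) : ℝ))‖ ≤
      B * |t| ^ 3 * V := by
    rw [← Complex.ofReal_exp, ← Complex.ofReal_sub, Complex.norm_real, Real.norm_eq_abs,
      abs_sub_comm]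
    have h := Real.abs_exp_sub_one_sub_id_le (x := -(t ^ 2 * V / 2)) (by
      rw [abs_neg, abs_of_nonneg hw0]; linarith)
    have he : Real.exp (-(t ^ 2 * V / 2)) - (1 - t ^ 2 * V / 2) =
      Real.exp (-(t ^ 2 * V / 2)) - 1 - -(t ^ 2 * V / 2) := by ring
    rw [he]
    refine h.trans ?_
    -- `t²V ≤ (B|t|)² ≤ B|t|`, so the square of `t²V/2` is at most `t²V · B|t|`
    have h3 : (B * |t|) ^ 2 ≤ B * |t| := by
      rw [sq]; exact mul_le_of_le_one_left (by positivity) ht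
    have h4 : (t ^ 2 * V) * (t ^ 2 * V) ≤ (t ^ 2 * V) * (B * |t|) :=
      mul_le_mul_of_nonneg_left (htV.trans h3) (by positivity)
    calc (-(t ^ 2 * V / 2)) ^ 2 = (t ^ 2 * V) * (t ^ 2 * V) / 4 := by ring
      _ ≤ (t ^ 2 * V) * (B * |t|) / 1 := by
          have : 0 ≤ (t ^ 2 * V) * (B * |t|) := by positivity
          linarith
      _ = B * |t| ^ 3 * V := by rw [← sq_abs t]; ring
  calc _ ≤ ‖charFun (P.map Z) t - (1 - t ^ 2 * V / 2 : ℝ)‖ +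
        ‖((1 - t ^ 2 * V / 2 : ℝ) : ℂ) - Complex.exp ((-(t ^ 2 * V / 2) : ℝ))‖ :=
        norm_sub_le_norm_sub_add_norm_sub _ _ _
    _ ≤ _ := by linarith

/-- The quantitative form of the central limit theorem for a sum of independent, centred and
uniformly bounded variables, on the side of characteristic functions. -/
lemma norm_charFun_map_sum_sub_gaussian_le {ι : Type*} [Fintype ι] {Z : ι → Ω → ℝ}
    (hZ : ∀ i, Measurable (Z i)) (hind : iIndepFun Z P) {B : ℝ}
    (hB : ∀ i ω, |Z i ω| ≤ B) (h0 : ∀ i, ∫ ω, Z i ω ∂P = 0) {t : ℝ} (ht : B * |t| ≤ 1) :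
    ‖charFun (P.map (fun ω => ∑ i, Z i ω)) t -
        Complex.exp ((-(t ^ 2 * variance (fun ω => ∑ i, Z i ω) P / 2) : ℝ))‖ ≤
      2 * (B * |t| ^ 3 * variance (fun ω => ∑ i, Z i ω) P) := by
  have hL2 : ∀ i, MemLp (Z i) 2 P := fun i => MemLp.of_bound (hZ i).aestronglyMeasurable B
    (Filter.Eventually.of_forall (hB i))
  have hvar : variance (fun ω => ∑ i, Z i ω) P = ∑ i, variance (Z i) P := by
    have := IndepFun.variance_sum (s := Finset.univ) (fun i _ => hL2 i)
      (fun i _ j _ hij => hind.indepFun hij)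
    rw [← this]
    congr 1; ext ω; simp
  rw [hvar, hind.charFun_map_fun_sum_eq_prod (fun i => (hZ i).aemeasurable), Finset.prod_apply]
  have hexp : Complex.exp ((-(t ^ 2 * (∑ i, variance (Z i) P) / 2) : ℝ)) =
      ∏ i, Complex.exp ((-(t ^ 2 * variance (Z i) P / 2) : ℝ)) := by
    rw [← Complex.exp_sum, ← Complex.ofReal_sum]
    congr 2
    rw [Finset.mul_sum, Finset.sum_div, Finset.sum_neg_distrib]
  rw [hexp]
  refine (norm_prod_sub_prod_le _ _ _ (fun i _ => ?_) (fun i _ => ?_)).trans ?_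
  · have := Measure.isProbabilityMeasure_map (μ := P) (hZ i).aemeasurable
    exact norm_charFun_le_one _
  · rw [← Complex.ofReal_exp, Complex.norm_real, Real.norm_eq_abs, Real.abs_exp,
      Real.exp_le_one_iff]
    have := variance_nonneg (Z i) P
    have : 0 ≤ t ^ 2 * variance (Z i) P / 2 := by positivity
    linarith
  · rw [Finset.mul_sum, Finset.mul_sum]
    exact Finset.sum_le_sum fun i _ => norm_charFun_map_sub_gaussian_le (hZ i) (hB i) (h0 i) ht

lemma integral_abs_le_sqrt_variance {T : Ω → ℝ} (hT : MemLp T 2 P) (h0 : ∫ ω, T ω ∂P = 0) :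
    ∫ ω, |T ω| ∂P ≤ √(variance T P) := by
  have h1 : Integrable T P := hT.integrable (by norm_num)
  have habs : MemLp (fun ω => |T ω|) 2 P := by simpa using hT.norm
  have h := variance_eq_sub habs
  have h2 := variance_nonneg (fun ω => |T ω|) P
  rw [variance_of_integral_eq_zero hT.aemeasurable h0]
  refine Real.le_sqrt_of_sq_le ?_
  have h3 : ∫ ω, ((fun ω => |T ω|) ^ 2) ω ∂P = ∫ ω, T ω ^ 2 ∂P := by
    congr 1; ext ω; simp
  rw [h3] at h
  linarith

/-- A bounded perturbation changes the variance by little compared with the variance itself. -/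
lemma abs_variance_add_sub_le {T e : Ω → ℝ} (hT : MemLp T 2 P) (hT0 : ∫ ω, T ω ∂P = 0)
    (he : Measurable e) (he0 : ∫ ω, e ω ∂P = 0) {C : ℝ} (hC : ∀ ω, |e ω| ≤ C) :
    |variance (fun ω => T ω + e ω) P - variance T P| ≤ 2 * C * √(variance T P) + C ^ 2 := by
  have hC0 : 0 ≤ C := by
    obtain ⟨ω⟩ : Nonempty Ω := nonempty_of_isProbabilityMeasure P
    exact (abs_nonneg _).trans (hC ω)
  have heL : MemLp e 2 P := MemLp.of_bound he.aestronglyMeasurable C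
    (Filter.Eventually.of_forall hC)
  have hTi : Integrable T P := hT.integrable (by norm_num)
  have hei : Integrable e P := heL.integrable (by norm_num)
  have hTe : Integrable (fun ω => T ω * e ω) P := hTi.mul_bdd (c := C) he.aestronglyMeasurable
    (Filter.Eventually.of_forall hC)
  have hT2 : Integrable (fun ω => T ω ^ 2) P := hT.integrable_sq
  have he2 : Integrable (fun ω => e ω ^ 2) P := heL.integrable_sq
  have hsum0 : ∫ ω, (T ω + e ω) ∂P = 0 := by rw [integral_add hTi hei, hT0, he0, add_zero]
  have hvar : variance (fun ω => T ω + e ω) P =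
      variance T P + (2 * ∫ ω, T ω * e ω ∂P) + ∫ ω, e ω ^ 2 ∂P := by
    rw [variance_of_integral_eq_zero (X := fun ω => T ω + e ω)
        (hT.aemeasurable.add he.aemeasurable) hsum0,
      variance_of_integral_eq_zero hT.aemeasurable hT0, ← integral_const_mul,
      ← integral_add hT2 (hTe.const_mul 2),
      ← integral_add (f := fun ω => T ω ^ 2 + 2 * (T ω * e ω)) (hT2.add (hTe.const_mul 2)) he2]
    congr 1; ext ω; ring
  have h1 : |∫ ω, T ω * e ω ∂P| ≤ C * √(variance T P) := by
    have : ‖∫ ω, T ω * e ω ∂P‖ ≤ ∫ ω, C * |T ω| ∂P := by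
      refine norm_integral_le_of_norm_le (hTi.abs.const_mul C)
        (Filter.Eventually.of_forall fun ω => ?_)
      rw [norm_mul, mul_comm, Real.norm_eq_abs, Real.norm_eq_abs]
      gcongr
      exact hC ω
    rw [integral_const_mul] at this
    refine this.trans ?_
    gcongr
    exact integral_abs_le_sqrt_variance hT hT0
  have h2 : |∫ ω, e ω ^ 2 ∂P| ≤ C ^ 2 := by
    rw [abs_of_nonneg (integral_nonneg fun ω => sq_nonneg _)]
    calc ∫ ω, e ω ^ 2 ∂P ≤ ∫ _, C ^ 2 ∂P := integral_mono he2 (integrable_const _) fun ω =>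
          sq_le_sq' (abs_le.1 (hC ω)).1 (abs_le.1 (hC ω)).2
      _ = C ^ 2 := by simp
  rw [hvar]
  rw [abs_le] at *
  constructor <;> linarith [h1.1, h1.2, h2.1, h2.2]

end Variables

/-- By Lévy's theorem and the portmanteau theorem, asymptotic normality follows from the
convergence of the characteristic functions of the standardized variables. -/
lemma asymptoticallyNormal_of_tendsto_charFun {Ω : ℕ → Type*} [∀ n, MeasurableSpace (Ω n)]
    (P : ∀ n, Measure (Ω n)) [∀ n, IsProbabilityMeasure (P n)] (X : ∀ n, Ω n → ℝ)
    (hX : ∀ n, Measurable (X n))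
    (h : ∀ t : ℝ, Filter.Tendsto
      (fun n => charFun ((P n).map
        (fun ω => (X n ω - ∫ ω', X n ω' ∂(P n)) / √(variance (X n) (P n)))) t)
      Filter.atTop (nhds (Complex.exp ((-(t ^ 2 / 2) : ℝ))))) :
    AsymptoticallyNormal P X := by
  have hm : ∀ n, Measurable
      (fun ω => (X n ω - ∫ ω', X n ω' ∂(P n)) / √(variance (X n) (P n))) :=
    fun n => ((hX n).sub_const _).div_const _
  let μ : ℕ → ProbabilityMeasure ℝ := fun n =>
    ⟨(P n).map (fun ω => (X n ω - ∫ ω', X n ω' ∂(P n)) / √(variance (X n) (P n))),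
      Measure.isProbabilityMeasure_map (hm n).aemeasurable⟩
  let μ₀ : ProbabilityMeasure ℝ := ⟨gaussianReal 0 1, inferInstance⟩
  have hμ : Filter.Tendsto μ Filter.atTop (nhds μ₀) := by
    refine ProbabilityMeasure.tendsto_iff_tendsto_charFun.2 fun t => ?_
    have : charFun (μ₀ : Measure ℝ) t = Complex.exp ((-(t ^ 2 / 2) : ℝ)) := by
      change charFun (gaussianReal 0 1) t = _
      rw [charFun_gaussianReal]
      congr 1
      push_cast
      ring
    rw [this]
    exact h t
  intro x
  have hfr : (μ₀ : Measure ℝ) (frontier (Set.Iic x)) = 0 := by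
    change gaussianReal 0 1 _ = 0
    rw [frontier_Iic]
    have := nullSingletonClass_gaussianReal (μ := 0) (v := 1) one_ne_zero
    exact measure_singleton _
  have hlim := ProbabilityMeasure.tendsto_measure_of_null_frontier_of_tendsto' hμ hfr
  have hlim' := (ENNReal.tendsto_toReal (measure_ne_top (μ₀ : Measure ℝ) _)).comp hlim
  refine hlim'.congr fun n => ?_
  change ((P n).map _ (Set.Iic x)).toReal = _
  rw [Measure.map_apply (hm n) measurableSet_Iic]
  rfl

/-- Central limit theorem for triangular arrays of uniformly bounded variables, independent in
each row, with a bounded error term that may depend on them: the error changes neither the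
variance nor the standardized variable in the limit, since the variances tend to infinity. -/
theorem asymptoticallyNormal_sum_add_bounded {Ω : ℕ → Type*} [∀ n, MeasurableSpace (Ω n)]
    (P : ∀ n, Measure (Ω n)) [∀ n, IsProbabilityMeasure (P n)] {ι : ℕ → Type*}
    [∀ n, Fintype (ι n)] (Y : ∀ n, ι n → Ω n → ℝ) (hY : ∀ n i, Measurable (Y n i))
    (hind : ∀ n, iIndepFun (Y n) (P n)) {B : ℝ} (hB : ∀ n i ω, |Y n i ω| ≤ B)
    (hvar : Filter.Tendsto (fun n => ∑ i, variance (Y n i) (P n)) Filter.atTop Filter.atTop)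
    (X : ∀ n, Ω n → ℝ) (hX : ∀ n, Measurable (X n)) (c : ℕ → ℝ) {C : ℝ}
    (hXY : ∀ n ω, |X n ω - (c n + ∑ i, Y n i ω)| ≤ C) :
    AsymptoticallyNormal P X := by
  have hint : ∀ n i, Integrable (Y n i) (P n) := fun n i =>
    Integrable.of_bound (hY n i).aestronglyMeasurable B (Filter.Eventually.of_forall (hB n i))
  have hL2 : ∀ n i, MemLp (Y n i) 2 (P n) := fun n i =>
    MemLp.of_bound (hY n i).aestronglyMeasurable B (Filter.Eventually.of_forall (hB n i))
  -- centred summands, centred sum, and centred error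
  set Z : ∀ n, ι n → Ω n → ℝ := fun n i ω => Y n i ω - ∫ ω', Y n i ω' ∂(P n) with hZdef
  set T : ∀ n, Ω n → ℝ := fun n ω => ∑ i, Z n i ω with hTdef
  set e₀ : ∀ n, Ω n → ℝ := fun n ω => X n ω - (c n + ∑ i, Y n i ω) with he₀def
  set e : ∀ n, Ω n → ℝ := fun n ω => e₀ n ω - ∫ ω', e₀ n ω' ∂(P n) with hedef
  have hZm : ∀ n i, Measurable (Z n i) := fun n i => (hY n i).sub_const _
  have hTm : ∀ n, Measurable (T n) := fun n =>
    Finset.measurable_fun_sum _ fun i _ => hZm n i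
  have hSm : ∀ n, Measurable fun ω => ∑ i, Y n i ω := fun n =>
    Finset.measurable_fun_sum _ fun i _ => hY n i
  have he₀m : ∀ n, Measurable (e₀ n) := fun n => (hX n).sub ((hSm n).const_add _)
  have hem : ∀ n, Measurable (e n) := fun n => (he₀m n).sub_const _
  have he₀i : ∀ n, Integrable (e₀ n) (P n) := fun n =>
    Integrable.of_bound (he₀m n).aestronglyMeasurable C (Filter.Eventually.of_forall (hXY n))
  have hmean : ∀ (n : ℕ) (f : Ω n → ℝ) (b : ℝ), (∀ ω, |f ω| ≤ b) → |∫ ω, f ω ∂(P n)| ≤ b := by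
    intro n f b hf
    have := norm_integral_le_of_norm_le_const (μ := P n) (f := f) (C := b)
      (Filter.Eventually.of_forall hf)
    simpa using this
  have hZB : ∀ n i ω, |Z n i ω| ≤ 2 * B := fun n i ω =>
    (abs_sub _ _).trans (by linarith [hB n i ω, hmean n (Y n i) B (hB n i)])
  have heC : ∀ n ω, |e n ω| ≤ 2 * C := fun n ω =>
    (abs_sub _ _).trans (by linarith [hXY n ω, hmean n (e₀ n) C (hXY n)])
  have hZ0 : ∀ n i, ∫ ω, Z n i ω ∂(P n) = 0 := fun n i => by
    rw [integral_sub (hint n i) (integrable_const _)]; simp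
  have he0 : ∀ n, ∫ ω, e n ω ∂(P n) = 0 := fun n => by
    rw [integral_sub (he₀i n) (integrable_const _)]; simp
  have hZi : ∀ n i, Integrable (Z n i) (P n) := fun n i => (hint n i).sub (integrable_const _)
  have hT0 : ∀ n, ∫ ω, T n ω ∂(P n) = 0 := fun n => by
    rw [integral_finsetSum _ fun i _ => hZi n i]
    simp [hZ0]
  have hTL : ∀ n, MemLp (T n) 2 (P n) := fun n =>
    memLp_finsetSum _ fun i _ => (hL2 n i).sub (memLp_const _)
  have hindZ : ∀ n, iIndepFun (Z n) (P n) := fun n =>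
    (hind n).comp (fun i x => x - ∫ ω', Y n i ω' ∂(P n)) (fun i => measurable_sub_const _)
  have hTvar : ∀ n, variance (T n) (P n) = ∑ i, variance (Y n i) (P n) := fun n => by
    have h := IndepFun.variance_sum (s := Finset.univ) (fun i _ => (hL2 n i).sub (memLp_const _))
      (fun i _ j _ hij => (hindZ n).indepFun hij)
    have h' : T n = ∑ i, Z n i := by ext ω; simp [hTdef]
    rw [h']
    refine h.trans (Finset.sum_congr rfl fun i _ => ?_)
    exact variance_sub_const (hY n i).aestronglyMeasurable _
  have hTi : ∀ n, Integrable (T n) (P n) := fun n => (hTL n).integrable (by norm_num)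
  have hei : ∀ n, Integrable (e n) (P n) := fun n => (he₀i n).sub (integrable_const _)
  -- centring removes the constants
  have hXc : ∀ n ω, X n ω - ∫ ω', X n ω' ∂(P n) = T n ω + e n ω := by
    intro n ω
    have hdec : ∀ ω, X n ω = (c n + ∑ i, ∫ ω', Y n i ω' ∂(P n)) + ∫ ω', e₀ n ω' ∂(P n) +
        (T n ω + e n ω) := fun ω => by
      simp only [hTdef, hZdef, hedef, he₀def, Finset.sum_sub_distrib]; ring
    have h1 : ∫ ω', X n ω' ∂(P n) =
        (c n + ∑ i, ∫ ω', Y n i ω' ∂(P n)) + ∫ ω', e₀ n ω' ∂(P n) := by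
      simp_rw [hdec]
      have hTe : Integrable (fun ω => T n ω + e n ω) (P n) := (hTi n).add (hei n)
      rw [integral_add (integrable_const _) hTe,
        integral_add (hTi n) (hei n), hT0, he0]
      simp
    rw [h1, hdec ω]; ring
  have hXvar : ∀ n, variance (X n) (P n) = variance (fun ω => T n ω + e n ω) (P n) := fun n => by
    rw [← variance_sub_const (hX n).aestronglyMeasurable (∫ ω', X n ω' ∂(P n))]
    simp_rw [hXc]
  set s : ℕ → ℝ := fun n => √(variance (T n) (P n)) with hs
  set r : ℕ → ℝ := fun n => √(variance (X n) (P n)) with hr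
  have hs_top : Filter.Tendsto s Filter.atTop Filter.atTop := by
    refine Real.tendsto_sqrt_atTop.comp ?_
    simpa only [hTvar] using hvar
  have hs_inv : Filter.Tendsto (fun n => (s n)⁻¹) Filter.atTop (nhds 0) :=
    tendsto_inv_atTop_zero.comp hs_top
  have hs_sq : ∀ n, s n ^ 2 = variance (T n) (P n) := fun n => Real.sq_sqrt (variance_nonneg _ _)
  have hs_pos : ∀ᶠ n in Filter.atTop, 0 < s n := hs_top.eventually_gt_atTop 0
  -- the ratio of the standard deviations tends to one
  have hratio_sq : Filter.Tendsto (fun n => variance (X n) (P n) / s n ^ 2) Filter.atTop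
      (nhds 1) := by
    rw [tendsto_iff_norm_sub_tendsto_zero]
    have hbound : Filter.Tendsto (fun n => 2 * (2 * C) * (s n)⁻¹ + (2 * C) ^ 2 * ((s n)⁻¹) ^ 2)
        Filter.atTop (nhds 0) := by
      have := (hs_inv.const_mul (2 * (2 * C))).add ((hs_inv.pow 2).const_mul ((2 * C) ^ 2))
      simpa using this
    refine tendsto_of_tendsto_of_tendsto_of_le_of_le' tendsto_const_nhds hbound
      (Filter.Eventually.of_forall fun n => norm_nonneg _) ?_
    filter_upwards [hs_pos] with n hn
    have h := abs_variance_add_sub_le (hTL n) (hT0 n) (hem n) (he0 n) (heC n)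
    rw [← hXvar n, ← hs_sq n] at h
    have h' : variance (X n) (P n) / s n ^ 2 - 1 =
        (variance (X n) (P n) - s n ^ 2) / s n ^ 2 := by field_simp
    rw [h', norm_div, Real.norm_eq_abs, Real.norm_eq_abs, abs_of_pos (pow_pos hn 2),
      div_le_iff₀ (pow_pos hn 2)]
    refine h.trans (le_of_eq ?_)
    rw [Real.sqrt_sq hn.le]
    field_simp
  have hratio : Filter.Tendsto (fun n => r n / s n) Filter.atTop (nhds 1) := by
    have h := hratio_sq.sqrt
    rw [Real.sqrt_one] at h
    refine h.congr fun n => ?_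
    rw [Real.sqrt_div (variance_nonneg _ _), Real.sqrt_sq (Real.sqrt_nonneg _)]
  have hratio' : Filter.Tendsto (fun n => s n / r n) Filter.atTop (nhds 1) := by
    have h := hratio.inv₀ one_ne_zero
    simpa using h
  refine asymptoticallyNormal_of_tendsto_charFun P X hX fun t => ?_
  -- the standardized sum, without the error
  have hW : Filter.Tendsto (fun n => charFun ((P n).map (fun ω => (s n)⁻¹ * T n ω)) t)
      Filter.atTop (nhds (Complex.exp ((-(t ^ 2 / 2) : ℝ)))) := by
    rw [tendsto_iff_norm_sub_tendsto_zero]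
    have hbound : Filter.Tendsto (fun n => 2 * (2 * B * |t| ^ 3) * (s n)⁻¹)
        Filter.atTop (nhds 0) := by simpa using hs_inv.const_mul (2 * (2 * B * |t| ^ 3))
    refine tendsto_of_tendsto_of_tendsto_of_le_of_le' tendsto_const_nhds hbound
      (Filter.Eventually.of_forall fun n => norm_nonneg _) ?_
    filter_upwards [hs_top.eventually_ge_atTop (2 * B * |t|), hs_pos] with n hn hpos
    rw [charFun_map_mul_comp (hTm n).aemeasurable]
    have hτ : |(s n)⁻¹ * t| = |t| / s n := by
      rw [abs_mul, abs_of_pos (inv_pos.2 hpos)]; field_simp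
    have h := norm_charFun_map_sum_sub_gaussian_le (hZm n) (hindZ n) (hZB n) (hZ0 n)
      (t := (s n)⁻¹ * t) (by rw [hτ, ← mul_div_assoc, div_le_one hpos]; exact hn)
    change ‖charFun ((P n).map (T n)) _ -
      Complex.exp ((-(((s n)⁻¹ * t) ^ 2 * variance (T n) (P n) / 2) : ℝ))‖ ≤
      2 * (2 * B * |(s n)⁻¹ * t| ^ 3 * variance (T n) (P n)) at h
    rw [← hs_sq n, hτ] at h
    have h1 : ((s n)⁻¹ * t) ^ 2 * s n ^ 2 / 2 = t ^ 2 / 2 := by field_simp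
    have h2 : 2 * (2 * B * (|t| / s n) ^ 3 * s n ^ 2) = 2 * (2 * B * |t| ^ 3) * (s n)⁻¹ := by
      field_simp
    rwa [h1, h2] at h
  -- the error does not matter
  have hdiff : Filter.Tendsto (fun n => charFun ((P n).map
        (fun ω => (X n ω - ∫ ω', X n ω' ∂(P n)) / √(variance (X n) (P n)))) t -
      charFun ((P n).map (fun ω => (s n)⁻¹ * T n ω)) t) Filter.atTop (nhds 0) := by
    rw [tendsto_zero_iff_norm_tendsto_zero]
    have hbound : Filter.Tendsto
        (fun n => |t| * (|s n / r n - 1| + 2 * C * ((s n)⁻¹ * (s n / r n))))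
        Filter.atTop (nhds 0) := by
      have h1 := (hratio'.sub_const 1).abs
      have h2 := (hs_inv.mul hratio').const_mul (2 * C)
      simpa using (h1.add h2).const_mul |t|
    refine tendsto_of_tendsto_of_tendsto_of_le_of_le' tendsto_const_nhds hbound
      (Filter.Eventually.of_forall fun n => norm_nonneg _) ?_
    filter_upwards [hs_pos] with n hpos
    have hr0 : 0 ≤ r n := Real.sqrt_nonneg _
    have hdec : ∀ ω, (X n ω - ∫ ω', X n ω' ∂(P n)) / r n - (s n)⁻¹ * T n ω =
        ((r n)⁻¹ - (s n)⁻¹) * T n ω + (r n)⁻¹ * e n ω := fun ω => by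
      rw [hXc, div_eq_mul_inv]; ring
    have hi : Integrable (fun ω => ((r n)⁻¹ - (s n)⁻¹) * T n ω + (r n)⁻¹ * e n ω) (P n) :=
      ((hTi n).const_mul _).add ((hei n).const_mul _)
    refine (norm_charFun_map_sub_le (((hX n).sub_const _).div_const _)
      ((hTm n).const_mul _)
      (hi.congr (Filter.Eventually.of_forall fun ω => (hdec ω).symm)) t).trans ?_
    refine mul_le_mul_of_nonneg_left ?_ (abs_nonneg t)
    refine (integral_congr_ae
      (Filter.Eventually.of_forall fun ω => congrArg abs (hdec ω))).le.trans ?_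
    have hb : ∫ ω, |((r n)⁻¹ - (s n)⁻¹) * T n ω + (r n)⁻¹ * e n ω| ∂(P n) ≤
        ∫ ω, (|(r n)⁻¹ - (s n)⁻¹| * |T n ω| + (r n)⁻¹ * (2 * C)) ∂(P n) := by
      refine integral_mono hi.abs (((hTi n).abs.const_mul _).add (integrable_const _)) fun ω => ?_
      refine (abs_add_le _ _).trans ?_
      simp only [abs_mul, abs_of_nonneg (inv_nonneg.2 hr0)]
      gcongr
      exact heC n ω
    refine hb.trans ?_
    rw [integral_add ((hTi n).abs.const_mul _) (integrable_const _), integral_const_mul]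
    have hTs := integral_abs_le_sqrt_variance (hTL n) (hT0 n)
    have h1 : |(r n)⁻¹ - (s n)⁻¹| * ∫ ω, |T n ω| ∂(P n) ≤ |s n / r n - 1| := by
      calc _ ≤ |(r n)⁻¹ - (s n)⁻¹| * s n := by gcongr
        _ = |((r n)⁻¹ - (s n)⁻¹) * s n| := by rw [abs_mul, abs_of_pos hpos]
        _ = |s n / r n - 1| := by
          congr 1
          rw [sub_mul, inv_mul_cancel₀ hpos.ne']; ring
    have h2 : (s n)⁻¹ * (s n / r n) = (r n)⁻¹ := by field_simp
    rw [h2]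
    simp only [integral_const, probReal_univ, one_smul]
    linarith
  simpa using hdiff.add hW

/-! ### Uniform laws on finite products -/

lemma uniformOn_univ_singleton {A : Type*} [Finite A] [MeasurableSpace A]
    [MeasurableSingletonClass A] (a : A) :
    uniformOn (Set.univ : Set A) {a} = (Nat.card A : ENNReal)⁻¹ := by
  have := Fintype.ofFinite A
  rw [uniformOn_univ, Measure.count_singleton, Nat.card_eq_fintype_card, one_div]

/-- A bijection onto a product carries the uniform law to the product of the uniform laws. -/
lemma measurePreserving_equiv_pi_uniformOn {ι Ω : Type*} [Fintype ι] {A : ι → Type*}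
    [∀ i, Finite (A i)] [∀ i, MeasurableSpace (A i)]
    [∀ i, MeasurableSingletonClass (A i)] [MeasurableSpace Ω] [DiscreteMeasurableSpace Ω]
    (e : Ω ≃ ∀ i, A i) :
    MeasurePreserving e (uniformOn Set.univ)
      (Measure.pi fun i => uniformOn (Set.univ : Set (A i))) := by
  have : Finite Ω := Finite.of_equiv _ e.symm
  refine ⟨Measurable.of_discrete, Measure.ext_of_singleton fun f => ?_⟩
  have hpre : e ⁻¹' {f} = {e.symm f} := by
    ext ω; simp [Equiv.eq_symm_apply]
  rw [Measure.map_apply Measurable.of_discrete (measurableSet_singleton _), hpre,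
    Measure.pi_singleton]
  simp_rw [uniformOn_univ_singleton]
  rw [Nat.card_congr e, Nat.card_pi, Nat.cast_prod, ENNReal.prod_inv_distrib]
  intro i _ j _ _
  exact Or.inr (ENNReal.natCast_ne_top _)

/-- A variable on a finite uniform space that takes two values at distance at least `g` has
variance bounded below in terms of `g` and the size of the space. -/
lemma le_variance_uniformOn {A : Type*} [Finite A] [Nonempty A] [MeasurableSpace A]
    [DiscreteMeasurableSpace A] {K : ℕ} (hK : Nat.card A ≤ K) (x : A → ℝ) {g : ℝ} (hg : 0 < g)
    {a b : A} (hab : g ≤ x a - x b) :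
    (K : ℝ)⁻¹ * (g ^ 2 / 2) ≤ variance x (uniformOn Set.univ) := by
  classical
  have := Fintype.ofFinite A
  have : IsProbabilityMeasure (uniformOn (Set.univ : Set A)) :=
    isProbabilityMeasure_uniformOn Set.finite_univ Set.univ_nonempty
  have hcard : (0 : ℝ) < Nat.card A := by exact_mod_cast Nat.card_pos
  rw [variance_eq_integral (Measurable.of_discrete.aemeasurable)]
  set m := ∫ y, x y ∂(uniformOn (Set.univ : Set A))
  rw [integral_fintype Integrable.of_finite]
  have hreal : ∀ y : A, (uniformOn (Set.univ : Set A)).real {y} = (Nat.card A : ℝ)⁻¹ := fun y => by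
    rw [measureReal_def, uniformOn_univ_singleton]; simp
  simp_rw [hreal, smul_eq_mul]
  have hne : a ≠ b := by rintro rfl; linarith
  calc (K : ℝ)⁻¹ * (g ^ 2 / 2) ≤ (Nat.card A : ℝ)⁻¹ * (g ^ 2 / 2) := by gcongr
    _ ≤ (Nat.card A : ℝ)⁻¹ * ((x a - m) ^ 2 + (x b - m) ^ 2) := by
        gcongr
        nlinarith [sq_nonneg (x a + x b - 2 * m)]
    _ = ∑ y ∈ ({a, b} : Finset A), (Nat.card A : ℝ)⁻¹ * (x y - m) ^ 2 := by
        rw [Finset.sum_pair hne]; ring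
    _ ≤ _ := Finset.sum_le_sum_of_subset_of_nonneg (Finset.subset_univ _)
        fun _ _ _ => by positivity

lemma tendsto_sum_fin_atTop {v : ℕ → ℝ} (h0 : ∀ i, 0 ≤ v i) {δ : ℝ} (hδ : 0 < δ)
    (hinf : {i | δ ≤ v i}.Infinite) :
    Filter.Tendsto (fun n => ∑ i : Fin (n + 1), v i) Filter.atTop Filter.atTop := by
  have hns : ¬ Summable v := fun hs => by
    have h := hs.tendsto_atTop_zero.eventually_lt_const hδ
    refine (Nat.frequently_atTop_iff_infinite.2 hinf) (h.mono fun i hi => ?_)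
    simpa using hi
  have h := (not_summable_iff_tendsto_nat_atTop_of_nonneg h0).1 hns
  refine (h.comp (Filter.tendsto_add_atTop_nat 1)).congr fun n => ?_
  exact (Fin.sum_univ_eq_sum_range v (n + 1)).symm

/-- If uniform spaces `Ω n` decompose as products of spaces `A i`, `i ≤ n`, of bounded size, then
variables that are, up to constants and bounded errors, sums of bounded functions of the
coordinates are asymptotically normal, provided infinitely many of these functions are
non-constant by a fixed amount. -/
theorem asymptoticallyNormal_uniformOn {A : ℕ → Type*} [∀ i, Finite (A i)] [∀ i, Nonempty (A i)]
    {K : ℕ} (hK : ∀ i, Nat.card (A i) ≤ K) (x : ∀ i, A i → ℝ) {B : ℝ}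
    (hB : ∀ i a, |x i a| ≤ B) {g : ℝ} (hg : 0 < g)
    (hinf : {i | ∃ a b, g ≤ x i a - x i b}.Infinite) {Ω : ℕ → Type*}
    [∀ n, MeasurableSpace (Ω n)] [∀ n, DiscreteMeasurableSpace (Ω n)]
    (e : ∀ n, Ω n ≃ ∀ i : Fin (n + 1), A i) (X : ∀ n, Ω n → ℝ) (c : ℕ → ℝ) {C : ℝ}
    (hX : ∀ n ω, |X n ω - (c n + ∑ i : Fin (n + 1), x i (e n ω i))| ≤ C) :
    AsymptoticallyNormal (fun n => uniformOn (Set.univ : Set (Ω n))) X := by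
  let _ : ∀ i, MeasurableSpace (A i) := fun _ => ⊤
  have hAprob : ∀ i, IsProbabilityMeasure (uniformOn (Set.univ : Set (A i))) := fun i =>
    isProbabilityMeasure_uniformOn Set.finite_univ Set.univ_nonempty
  have : ∀ n, Finite (Ω n) := fun n => Finite.of_equiv _ (e n).symm
  have : ∀ n, Nonempty (Ω n) := fun n => (e n).nonempty
  have : ∀ n, IsProbabilityMeasure (uniformOn (Set.univ : Set (Ω n))) := fun n =>
    isProbabilityMeasure_uniformOn Set.finite_univ Set.univ_nonempty
  have hmp := fun n => measurePreserving_equiv_pi_uniformOn (e n)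
  have hvar : ∀ n (i : Fin (n + 1)), variance (fun ω => x i (e n ω i)) (uniformOn Set.univ) =
      variance (x i) (uniformOn (Set.univ : Set (A i))) := fun n i =>
    ((measurePreserving_eval (fun i : Fin (n + 1) => uniformOn (Set.univ : Set (A i))) i).comp
      (hmp n)).variance_fun_comp Measurable.of_discrete.aemeasurable
  refine asymptoticallyNormal_sum_add_bounded _ (fun n (i : Fin (n + 1)) ω => x i (e n ω i))
    (fun _ _ => Measurable.of_discrete) (fun n => ?_) (fun n i ω => hB _ _) ?_ X
    (fun _ => Measurable.of_discrete) c hX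
  · have h := iIndepFun_pi (μ := fun i : Fin (n + 1) => uniformOn (Set.univ : Set (A i)))
      (X := fun i => x i) (fun i => Measurable.of_discrete.aemeasurable)
    rw [iIndepFun_iff_map_fun_eq_pi_map fun i => Measurable.of_discrete.aemeasurable] at h ⊢
    have hmap : ∀ {β : Type} [MeasurableSpace β] (f : (∀ i : Fin (n + 1), A i) → β),
        (Measure.pi fun i : Fin (n + 1) => uniformOn (Set.univ : Set (A i))).map f =
          (uniformOn (Set.univ : Set (Ω n))).map (f ∘ e n) := fun f => by
      rw [← (hmp n).map_eq, Measure.map_map Measurable.of_discrete (hmp n).measurable]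
    simp_rw [hmap] at h
    exact h
  · simp_rw [hvar]
    have hK0 : 0 < K := Nat.card_pos.trans_le (hK 0)
    refine tendsto_sum_fin_atTop (v := fun i => variance (x i) (uniformOn (Set.univ : Set (A i))))
      (fun i => variance_nonneg _ _) (δ := (K : ℝ)⁻¹ * (g ^ 2 / 2)) (by positivity)
      (hinf.mono ?_)
    rintro i ⟨a, b, hab⟩
    exact le_variance_uniformOn (hK i) (x i) hg hab

/-! ### Counting the classes generated by two involutions -/

lemma card_quot_le_of_forall_eqvGen {X : Type*} [Finite X] {r s : X → X → Prop}
    (h : ∀ x y, r x y → Relation.EqvGen s x y) : Nat.card (Quot s) ≤ Nat.card (Quot r) := by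
  refine Nat.card_le_card_of_surjective
    (Quot.lift (fun x => Quot.mk s x) fun x y hxy => Quot.eqvGen_sound (h x y hxy)) ?_
  rintro ⟨x⟩
  exact ⟨Quot.mk r x, rfl⟩

lemma card_quot_eq_of_forall_eqvGen {X : Type*} [Finite X] {r s : X → X → Prop}
    (h : ∀ x y, r x y → Relation.EqvGen s x y) (h' : ∀ x y, s x y → Relation.EqvGen r x y) :
    Nat.card (Quot r) = Nat.card (Quot s) :=
  le_antisymm (card_quot_le_of_forall_eqvGen h') (card_quot_le_of_forall_eqvGen h)

/-- The relation `r` with one more related pair `(a, c)`. -/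
def addPair {X : Type*} (r : X → X → Prop) (a c : X) (x y : X) : Prop :=
  r x y ∨ (x = a ∧ y = c)

lemma card_quot_addPair_of_eqvGen {X : Type*} [Finite X] {r : X → X → Prop} {a c : X}
    (h : Relation.EqvGen r a c) : Nat.card (Quot (addPair r a c)) = Nat.card (Quot r) := by
  refine card_quot_eq_of_forall_eqvGen ?_ fun x y hxy => .rel _ _ (Or.inl hxy)
  rintro x y (hxy | ⟨rfl, rfl⟩)
  exacts [.rel _ _ hxy, h]

lemma card_quot_addPair_of_not_eqvGen {X : Type*} [Finite X] {r : X → X → Prop} {a c : X}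
    (h : ¬ Relation.EqvGen r a c) :
    Nat.card (Quot (addPair r a c)) + 1 = Nat.card (Quot r) := by
  classical
  have hac : Quot.mk r a ≠ Quot.mk r c := fun h' => h (Quot.eqvGen_exact h')
  have hcongr : ∀ x y, addPair r a c x y →
      (if Quot.mk r x = Quot.mk r c then Quot.mk r a else Quot.mk r x) =
      (if Quot.mk r y = Quot.mk r c then Quot.mk r a else Quot.mk r y) := by
    rintro x y (hxy | ⟨rfl, rfl⟩)
    · rw [Quot.sound hxy]
    · simp
  let e : Quot (addPair r a c) ≃ {p : Quot r // p ≠ Quot.mk r c} :=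
    { toFun := fun p => ⟨Quot.lift _ hcongr p, by
        induction p using Quot.ind with | _ x =>
        change (if Quot.mk r x = Quot.mk r c then Quot.mk r a else Quot.mk r x) ≠ _
        split_ifs with hx
        exacts [hac, hx]⟩
      invFun := fun p => Quot.lift (fun x => Quot.mk (addPair r a c) x)
        (fun x y hxy => Quot.sound (Or.inl hxy)) p.1
      left_inv := by
        rintro ⟨x⟩
        change Quot.lift (fun x => Quot.mk (addPair r a c) x) _
          (if Quot.mk r x = Quot.mk r c then Quot.mk r a else Quot.mk r x) = _
        split_ifs with hx
        · have h1 : Quot.mk (addPair r a c) a = Quot.mk (addPair r a c) c :=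
            Quot.sound (Or.inr ⟨rfl, rfl⟩)
          have h2 : Quot.mk (addPair r a c) x = Quot.mk (addPair r a c) c :=
            Quot.eqvGen_sound ((Quot.eqvGen_exact hx).mono fun _ _ h => Or.inl h)
          exact h1.trans h2.symm
        · rfl
      right_inv := by
        rintro ⟨⟨x⟩, hx⟩
        exact Subtype.ext (if_neg hx) }
  rw [Nat.card_congr e, ← Finite.card_option, Nat.card_congr (Equiv.optionSubtypeNe _)]

lemma card_quot_le_card_quot_addPair_add_one {X : Type*} [Finite X] (r : X → X → Prop) (a c : X) :
    Nat.card (Quot r) ≤ Nat.card (Quot (addPair r a c)) + 1 := by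
  by_cases h : Relation.EqvGen r a c
  · rw [card_quot_addPair_of_eqvGen h]; exact Nat.le_succ _
  · exact (card_quot_addPair_of_not_eqvGen h).ge

lemma card_quot_addPair_le {X : Type*} [Finite X] (r : X → X → Prop) (a c : X) :
    Nat.card (Quot (addPair r a c)) ≤ Nat.card (Quot r) :=
  card_quot_le_of_forall_eqvGen fun _ _ hxy => .rel _ _ (Or.inl hxy)

/-- Relates every point to its images under `α` and `β`. -/
def stepRel {X : Type*} (α β : X → X) (x y : X) : Prop := y = α x ∨ y = β x

lemma even_card_of_involution {X : Type*} (s : Finset X) {f : X → X}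
    (hf : Function.Involutive f) (hfix : ∀ x, f x ≠ x) (hs : ∀ x ∈ s, f x ∈ s) :
    Even s.card := by
  have h : ∑ _x ∈ s, (1 : ZMod 2) = 0 :=
    Finset.sum_involution (fun x _ => f x) (fun _ _ => by decide) (fun x _ _ => hfix x)
      (fun x hx => hs x hx) fun x _ => hf x
  rw [Finset.sum_const, nsmul_eq_mul, mul_one] at h
  exact (ZMod.natCast_eq_zero_iff_even).1 h

/-- Parity: a set that is closed under `α`, and under `β` except perhaps at `a` and at `β a`,
contains with `a` also `β a`. This says that a cycle formed by the two involutions stays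
connected when one link is removed. -/
lemma apply_mem_of_involutions {X : Type*} [Finite X] {α β : X → X}
    (hα : Function.Involutive α) (hαfix : ∀ x, α x ≠ x)
    (hβ : Function.Involutive β) (hβfix : ∀ x, β x ≠ x) {K : Set X} {a : X} (ha : a ∈ K)
    (hKα : ∀ x ∈ K, α x ∈ K) (hKβ : ∀ x ∈ K, x ≠ a → x ≠ β a → β x ∈ K) : β a ∈ K := by
  classical
  have := Fintype.ofFinite X
  by_contra hb
  have h1 := even_card_of_involution K.toFinset hα hαfix (by simpa using hKα)
  have h2 := even_card_of_involution (K.toFinset.erase a) hβ hβfix (by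
    intro x hx
    simp only [Finset.mem_erase, Set.mem_toFinset] at hx ⊢
    refine ⟨fun h => hb ?_, hKβ x hx.2 hx.1 fun h => hb (h ▸ hx.2)⟩
    rw [← h, hβ]; exact hx.2)
  have h3 := Finset.card_erase_add_one (s := K.toFinset) (a := a) (by simpa using ha)
  rw [← h3] at h1
  exact (Nat.even_add_one.1 h1) h2

section Switch

variable {X : Type*} {α β β' : X → X} {a b c d : X}

/-- Once the four points involved are identified, a switch of the second involution, from the
links `ab`, `cd` to the links `ac`, `bd`, no longer matters. -/
lemma eqvGen_addPair_of_switch (hab : β a = b) (hac : β' a = c) (hbd : β' b = d) (hca : β' c = a)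
    (hdb : β' d = b) (hcd : β c = d)
    (heq : ∀ x, x ≠ a → x ≠ b → x ≠ c → x ≠ d → β' x = β x) (x y : X)
    (hxy : addPair (stepRel α β') a b x y) :
    Relation.EqvGen (addPair (stepRel α β) a c) x y := by
  have eab : Relation.EqvGen (addPair (stepRel α β) a c) a b := .rel _ _ (.inl (.inr hab.symm))
  have eac : Relation.EqvGen (addPair (stepRel α β) a c) a c := .rel _ _ (.inr ⟨rfl, rfl⟩)
  have ecd : Relation.EqvGen (addPair (stepRel α β) a c) c d := .rel _ _ (.inl (.inr hcd.symm))
  have ebd : Relation.EqvGen (addPair (stepRel α β) a c) b d :=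
    (eab.symm _ _).trans _ _ _ (eac.trans _ _ _ ecd)
  obtain (h | h) | ⟨rfl, rfl⟩ := hxy
  · exact .rel _ _ (.inl (.inl h))
  · by_cases ha : x = a
    · subst ha; rw [h, hac]; exact eac
    by_cases hb : x = b
    · subst hb; rw [h, hbd]; exact ebd
    by_cases hc : x = c
    · subst hc; rw [h, hca]; exact eac.symm _ _
    by_cases hd : x = d
    · subst hd; rw [h, hdb]; exact ebd.symm _ _
    · exact .rel _ _ (.inl (.inr (by rw [h, heq x ha hb hc hd])))
  · exact eab

variable [Finite X]

lemma card_quot_addPair_switch (hβ : Function.Involutive β) (hβ' : Function.Involutive β')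
    (hab : β a = b) (hcd : β c = d) (hac : β' a = c) (hbd : β' b = d)
    (heq : ∀ x, x ≠ a → x ≠ b → x ≠ c → x ≠ d → β' x = β x) :
    Nat.card (Quot (addPair (stepRel α β) a c)) = Nat.card (Quot (addPair (stepRel α β') a b)) := by
  have hca : β' c = a := by rw [← hac, hβ']
  have hdb : β' d = b := by rw [← hbd, hβ']
  have hba : β b = a := by rw [← hab, hβ]
  have hdc : β d = c := by rw [← hcd, hβ]
  exact card_quot_eq_of_forall_eqvGen
    (eqvGen_addPair_of_switch hac hab hcd hba hdc hbd fun x ha hc hb hd =>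
      (heq x ha hb hc hd).symm)
    (eqvGen_addPair_of_switch hab hac hbd hca hdb hcd heq)

lemma abs_card_quot_switch_sub_le (hβ : Function.Involutive β) (hβ' : Function.Involutive β')
    (hab : β a = b) (hcd : β c = d) (hac : β' a = c) (hbd : β' b = d)
    (heq : ∀ x, x ≠ a → x ≠ b → x ≠ c → x ≠ d → β' x = β x) :
    |(Nat.card (Quot (stepRel α β')) : ℤ) - Nat.card (Quot (stepRel α β))| ≤ 1 := by
  have h := card_quot_addPair_switch (α := α) hβ hβ' hab hcd hac hbd heq
  have h1 := card_quot_le_card_quot_addPair_add_one (stepRel α β) a c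
  have h2 := card_quot_addPair_le (stepRel α β) a c
  have h3 := card_quot_le_card_quot_addPair_add_one (stepRel α β') a b
  have h4 := card_quot_addPair_le (stepRel α β') a b
  rw [abs_le]
  omega

/-- A switch between two different classes merges them. -/
lemma card_quot_switch_of_not_eqvGen (hα : Function.Involutive α) (hαfix : ∀ x, α x ≠ x)
    (hβ : Function.Involutive β) (hβ' : Function.Involutive β') (hβfix : ∀ x, β x ≠ x)
    (hab : β a = b) (hcd : β c = d) (hac : β' a = c) (hbd : β' b = d)
    (heq : ∀ x, x ≠ a → x ≠ b → x ≠ c → x ≠ d → β' x = β x)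
    (hnot : ¬ Relation.EqvGen (stepRel α β) a c) :
    Nat.card (Quot (stepRel α β')) + 1 = Nat.card (Quot (stepRel α β)) := by
  rw [← card_quot_addPair_of_not_eqvGen hnot,
    card_quot_addPair_switch (α := α) hβ hβ' hab hcd hac hbd heq, card_quot_addPair_of_eqvGen]
  have hnotd : ¬ Relation.EqvGen (stepRel α β) a d := fun h =>
    hnot (h.trans _ _ _ ((Relation.EqvGen.rel c d (Or.inr hcd.symm)).symm _ _))
  -- the part of the class of `a` that is still reached from `a` after the switch
  have hmem := apply_mem_of_involutions hα hαfix hβ hβfix (a := a)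
    (K := {x | Relation.EqvGen (stepRel α β) a x ∧ Relation.EqvGen (stepRel α β') a x})
    ⟨.refl _, .refl _⟩
    (fun x hx => ⟨hx.1.trans _ _ _ (.rel _ _ (.inl rfl)), hx.2.trans _ _ _ (.rel _ _ (.inl rfl))⟩)
    (fun x hx hxa hxb => ⟨hx.1.trans _ _ _ (.rel _ _ (.inr rfl)),
      hx.2.trans _ _ _ (.rel _ _ (.inr (heq x hxa (hab ▸ hxb) (fun h => hnot (h ▸ hx.1))
        fun h => hnotd (h ▸ hx.1)).symm))⟩)
  rw [hab] at hmem
  exact hmem.2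

end Switch

namespace Multigraph

/-! ### Faces of a permutation of the darts -/

variable {E : Type*}

/-- The side across the edge from a given side, for the set `tw` of twisted edges. -/
def edgeSide (tw : E → Bool) (x : (E × Bool) × Bool) : (E × Bool) × Bool :=
  (flip E x.1, (!x.2) ^^ tw x.1.1)

/-- The side across the corner from a given side, for the rotation `r`. -/
def cornerSide (r : Equiv.Perm (E × Bool)) : (E × Bool) × Bool → (E × Bool) × Bool
  | (d, true) => (r d, false)
  | (d, false) => (r.symm d, true)

/-- The number of faces described by the rotation `r` and the set `tw` of twisted edges. Vertices
play no role, and fixed darts of `r` are allowed, so this makes sense for disjoint unions. -/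
noncomputable def faceNum (r : Equiv.Perm (E × Bool)) (tw : E → Bool) : ℕ :=
  Nat.card (Quot (stepRel (edgeSide tw) (cornerSide r)))

@[simp] lemma flip_fst (d : E × Bool) : (flip E d).1 = d.1 := rfl

@[simp] lemma flip_snd (d : E × Bool) : (flip E d).2 = !d.2 := rfl

@[simp] lemma flip_flip (d : E × Bool) : flip E (flip E d) = d := by
  ext <;> simp

lemma flip_ne (d : E × Bool) : flip E d ≠ d := fun h => by
  have := congrArg Prod.snd h
  simp at this

lemma edgeSide_involutive (tw : E → Bool) : Function.Involutive (edgeSide tw) := by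
  rintro ⟨d, s⟩
  simp only [edgeSide, flip_flip, flip_fst, Prod.mk.injEq, true_and]
  cases s <;> cases tw d.1 <;> rfl

lemma edgeSide_ne (tw : E → Bool) (x : (E × Bool) × Bool) : edgeSide tw x ≠ x := fun h =>
  flip_ne x.1 (congrArg Prod.fst h)

lemma cornerSide_involutive (r : Equiv.Perm (E × Bool)) : Function.Involutive (cornerSide r) := by
  rintro ⟨d, s⟩
  cases s <;> simp [cornerSide]

lemma cornerSide_ne (r : Equiv.Perm (E × Bool)) (x : (E × Bool) × Bool) :
    cornerSide r x ≠ x := by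
  obtain ⟨d, s⟩ := x
  cases s <;> simp [cornerSide]

section Swap

variable {r : Equiv.Perm (E × Bool)} {x y : E × Bool}

lemma cornerSide_true_of_fixed (hx : r x = x) : cornerSide r (x, true) = (x, false) := by
  simp [cornerSide, hx]

lemma cornerSide_false_of_fixed (hx : r x = x) : cornerSide r (x, false) = (x, true) := by
  simp [cornerSide, Equiv.symm_apply_eq, hx]

variable [DecidableEq E]

lemma cornerSide_swap_mul_of_ne (hx : r x = x) (hy : r y = y) (z : (E × Bool) × Bool)
    (h1 : z ≠ (x, true)) (h2 : z ≠ (x, false)) (h3 : z ≠ (y, false)) (h4 : z ≠ (y, true)) :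
    cornerSide (Equiv.swap x y * r) z = cornerSide r z := by
  obtain ⟨d, s⟩ := z
  have hdx : d ≠ x := by rintro rfl; cases s <;> simp_all
  have hdy : d ≠ y := by rintro rfl; cases s <;> simp_all
  cases s
  · change ((Equiv.swap x y * r).symm d, true) = (r.symm d, true)
    rw [(Equiv.symm_apply_eq _).2]
    rw [Equiv.Perm.mul_apply, Equiv.apply_symm_apply, Equiv.swap_apply_of_ne_of_ne hdx hdy]
  · change (Equiv.swap x y (r d), false) = (r d, false)
    rw [Equiv.swap_apply_of_ne_of_ne]
    · exact fun h => hdx (r.injective (h.trans hx.symm))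
    · exact fun h => hdy (r.injective (h.trans hy.symm))

lemma cornerSide_swap_mul_left_true (hx : r x = x) :
    cornerSide (Equiv.swap x y * r) (x, true) = (y, false) := by
  simp [cornerSide, hx]

lemma cornerSide_swap_mul_left_false (hy : r y = y) :
    cornerSide (Equiv.swap x y * r) (x, false) = (y, true) := by
  simp [cornerSide, Equiv.symm_apply_eq, hy]

variable [Finite E]

/-- Joining two vertices of degree one changes the number of faces by at most one. -/
lemma abs_faceNum_swap_mul_sub_le (tw : E → Bool) (hx : r x = x) (hy : r y = y) :
    |(faceNum (Equiv.swap x y * r) tw : ℤ) - faceNum r tw| ≤ 1 :=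
  abs_card_quot_switch_sub_le (cornerSide_involutive _) (cornerSide_involutive _)
    (cornerSide_true_of_fixed hx) (cornerSide_false_of_fixed hy)
    (cornerSide_swap_mul_left_true hx) (cornerSide_swap_mul_left_false hy)
    (cornerSide_swap_mul_of_ne hx hy)

/-- Joining two vertices of degree one that lie on different faces merges these faces. -/
lemma faceNum_swap_mul_of_not_eqvGen (tw : E → Bool) (hx : r x = x) (hy : r y = y)
    (hnot : ¬ Relation.EqvGen (stepRel (edgeSide tw) (cornerSide r)) (x, true) (y, false)) :
    faceNum (Equiv.swap x y * r) tw + 1 = faceNum r tw :=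
  card_quot_switch_of_not_eqvGen (edgeSide_involutive tw) (edgeSide_ne tw)
    (cornerSide_involutive _) (cornerSide_involutive _) (cornerSide_ne r)
    (cornerSide_true_of_fixed hx) (cornerSide_false_of_fixed hy)
    (cornerSide_swap_mul_left_true hx) (cornerSide_swap_mul_left_false hy)
    (cornerSide_swap_mul_of_ne hx hy) hnot

end Swap

/-! ### Chains of swaps -/

section Chain

variable {D : Type*}

/-- The first `m` pairs `x k`, `y k` are pairwise disjoint pairs of different elements. -/
structure DisjointPairs (x y : ℕ → D) (m : ℕ) : Prop where
  left : ∀ j < m, ∀ k < m, x j = x k → j = k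
  right : ∀ j < m, ∀ k < m, y j = y k → j = k
  left_ne_right : ∀ j < m, ∀ k < m, x j ≠ y k

lemma DisjointPairs.mono {x y : ℕ → D} {m n : ℕ} (h : DisjointPairs x y n) (hmn : m ≤ n) :
    DisjointPairs x y m where
  left j hj k hk := h.left j (hj.trans_le hmn) k (hk.trans_le hmn)
  right j hj k hk := h.right j (hj.trans_le hmn) k (hk.trans_le hmn)
  left_ne_right j hj k hk := h.left_ne_right j (hj.trans_le hmn) k (hk.trans_le hmn)

variable [DecidableEq D]

/-- The product of the swaps of `x k` and `y k`, for `k < m`. -/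
def swapProd (x y : ℕ → D) : ℕ → Equiv.Perm D
  | 0 => 1
  | m + 1 => Equiv.swap (x m) (y m) * swapProd x y m

lemma swapProd_apply_of_ne {x y : ℕ → D} {m : ℕ} {z : D} (hx : ∀ k < m, z ≠ x k)
    (hy : ∀ k < m, z ≠ y k) : swapProd x y m z = z := by
  induction m with
  | zero => rfl
  | succ m ih =>
    rw [swapProd, Equiv.Perm.mul_apply, ih (fun k hk => hx k (hk.trans m.lt_succ_self))
      (fun k hk => hy k (hk.trans m.lt_succ_self)),
      Equiv.swap_apply_of_ne_of_ne (hx m m.lt_succ_self) (hy m m.lt_succ_self)]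

lemma swapProd_apply_left {x y : ℕ → D} {m : ℕ} (h : DisjointPairs x y m) {k : ℕ} (hk : k < m) :
    swapProd x y m (x k) = y k := by
  induction m with
  | zero => exact absurd hk (Nat.not_lt_zero _)
  | succ m ih =>
    have hm := m.lt_succ_self
    rw [swapProd, Equiv.Perm.mul_apply]
    obtain hkm | rfl := Nat.lt_succ_iff_lt_or_eq.1 hk
    · rw [ih (h.mono hm.le) hkm, Equiv.swap_apply_of_ne_of_ne]
      · exact (h.left_ne_right m hm k hk).symm
      · exact fun h' => hkm.ne (h.right k hk m hm h')
    · rw [swapProd_apply_of_ne (fun j hj h' => hj.ne (h.left k hk j (hj.trans hm) h').symm)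
        (fun j hj => h.left_ne_right k hk j (hj.trans hm)), Equiv.swap_apply_left]

lemma swapProd_apply_right {x y : ℕ → D} {m : ℕ} (h : DisjointPairs x y m) {k : ℕ} (hk : k < m) :
    swapProd x y m (y k) = x k := by
  induction m with
  | zero => exact absurd hk (Nat.not_lt_zero _)
  | succ m ih =>
    have hm := m.lt_succ_self
    rw [swapProd, Equiv.Perm.mul_apply]
    obtain hkm | rfl := Nat.lt_succ_iff_lt_or_eq.1 hk
    · rw [ih (h.mono hm.le) hkm, Equiv.swap_apply_of_ne_of_ne]
      · exact fun h' => hkm.ne (h.left k hk m hm h')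
      · exact h.left_ne_right k hk m hm
    · rw [swapProd_apply_of_ne (fun j hj => (h.left_ne_right j (hj.trans hm) k hk).symm)
        (fun j hj h' => hj.ne (h.right k hk j (hj.trans hm) h').symm), Equiv.swap_apply_right]

end Chain

variable [DecidableEq E]

lemma max_pos_swapProd {x y : ℕ → E × Bool} {pos : E → ℕ} {m : ℕ}
    (hx : ∀ k < m, pos (x k).1 = k) (hy : ∀ k < m, pos (y k).1 = k + 1) (d : E × Bool) :
    max (pos (swapProd x y m d).1) m = max (pos d.1) m := by
  induction m with
  | zero => rfl
  | succ m ih =>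
    have ih := ih (fun k hk => hx k (hk.trans m.lt_succ_self))
      (fun k hk => hy k (hk.trans m.lt_succ_self))
    have hx := hx m m.lt_succ_self
    have hy := hy m m.lt_succ_self
    rw [swapProd, Equiv.Perm.mul_apply]
    have hswap : ∀ z : E × Bool,
        max (pos (Equiv.swap (x m) (y m) z).1) (m + 1) = max (pos z.1) (m + 1) := fun z => by
      rw [Equiv.swap_apply_def]
      split_ifs with h1 h2
      · rw [h1, hx, hy]; omega
      · rw [h2, hx, hy]; omega
      · rfl
    rw [hswap]
    omega

/-- If the edges carry levels, faces stay within a level, and the swaps join level after level in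
increasing order, then every swap merges two faces. -/
lemma faceNum_swapProd_mul_add [Finite E] (tw : E → Bool) {r : Equiv.Perm (E × Bool)}
    {x y : ℕ → E × Bool} {m : ℕ} (hdisj : DisjointPairs x y m)
    (hxr : ∀ k < m, r (x k) = x k) (hyr : ∀ k < m, r (y k) = y k) {pos : E → ℕ}
    (hpos : ∀ d, pos (r d).1 = pos d.1)
    (hx : ∀ k < m, pos (x k).1 = k) (hy : ∀ k < m, pos (y k).1 = k + 1) :
    faceNum (swapProd x y m * r) tw + m = faceNum r tw := by
  induction m with
  | zero => simp [swapProd]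
  | succ m ih =>
    have hm := m.lt_succ_self
    have hx' : ∀ k < m, pos (x k).1 = k := fun k hk => hx k (hk.trans hm)
    have hy' : ∀ k < m, pos (y k).1 = k + 1 := fun k hk => hy k (hk.trans hm)
    have ih := ih (hdisj.mono hm.le) (fun k hk => hxr k (hk.trans hm))
      (fun k hk => hyr k (hk.trans hm)) hx' hy'
    rw [← ih, swapProd, mul_assoc]
    set r' := swapProd x y m * r with hr'
    have hr'pos : ∀ d, max (pos (r' d).1) m = max (pos d.1) m := fun d => by
      rw [hr', Equiv.Perm.mul_apply, max_pos_swapProd hx' hy', hpos]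
    have hinv : ∀ s t, Relation.EqvGen (stepRel (edgeSide tw) (cornerSide r')) s t →
        max (pos s.1.1) m = max (pos t.1.1) m := by
      intro s t hst
      induction hst with
      | rel s t h =>
        obtain rfl | rfl := h
        · rfl
        · obtain ⟨d, _ | _⟩ := s
          · change _ = max (pos (r'.symm d).1) m
            rw [← hr'pos (r'.symm d), Equiv.apply_symm_apply]
          · exact (hr'pos d).symm
      | refl => rfl
      | symm _ _ _ h => exact h.symm
      | trans _ _ _ _ _ h1 h2 => exact h1.trans h2
    have hxf : r' (x m) = x m := by
      rw [hr', Equiv.Perm.mul_apply, hxr m hm]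
      exact swapProd_apply_of_ne (fun j hj h' => hj.ne (hdisj.left m hm j (hj.trans hm) h').symm)
        (fun j hj => hdisj.left_ne_right m hm j (hj.trans hm))
    have hyf : r' (y m) = y m := by
      rw [hr', Equiv.Perm.mul_apply, hyr m hm]
      exact swapProd_apply_of_ne (fun j hj => (hdisj.left_ne_right j (hj.trans hm) m hm).symm)
        (fun j hj h' => hj.ne (hdisj.right m hm j (hj.trans hm) h').symm)
    have h := faceNum_swap_mul_of_not_eqvGen tw hxf hyf fun h => by
      have := hinv _ _ h
      simp only [hx m hm, hy m hm] at this
      omega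
    omega

end Multigraph

/-! ### Cycles of a permutation and invariant functions -/

lemma Equiv.Perm.SameCycle.apply_eq_of_invariant {D γ : Type*} {r : Equiv.Perm D} {f : D → γ}
    (hf : ∀ d, f (r d) = f d) {d d' : D} (h : r.SameCycle d d') : f d = f d' := by
  obtain ⟨k, rfl⟩ := h
  induction k using Int.induction_on with
  | zero => rfl
  | succ k ih => rw [ih, add_comm, zpow_add, Equiv.Perm.mul_apply, zpow_one, hf]
  | pred k ih =>
    rw [ih, sub_eq_add_neg, add_comm, zpow_add, Equiv.Perm.mul_apply, zpow_neg_one,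
      ← hf (r⁻¹ _)]
    exact congrArg f (Equiv.apply_symm_apply r _).symm

lemma Equiv.Perm.SameCycle.mem_of_forall_apply_mem {D : Type*} [Finite D] {r : Equiv.Perm D}
    {S : Set D} (hS : ∀ d ∈ S, r d ∈ S) {d d' : D} (h : r.SameCycle d d') (hd : d ∈ S) :
    d' ∈ S := by
  obtain ⟨k, rfl⟩ := h.exists_nat_pow_eq
  induction k with
  | zero => exact hd
  | succ k ih =>
    rw [pow_succ', Equiv.Perm.mul_apply]
    exact hS _ (ih ⟨k, by simp⟩)

namespace Multigraph

/-! ### The face count of a rotation system -/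

section FaceCount

variable {V E : Type*} {G : Multigraph V E}

lemma SignedRotationSystem.faceCount_eq [Finite E] (ρ : SignedRotationSystem G) :
    ρ.faceCount = faceNum ρ.rot ρ.twist + G.isolatedCount := by
  rw [SignedRotationSystem.faceCount, faceNum]
  congr 1
  refine card_quot_eq_of_forall_eqvGen ?_ ?_
  · rintro _ _ (d | ⟨d, s⟩)
    · exact .rel _ _ (Or.inr rfl)
    · exact .rel _ _ (Or.inl rfl)
  · rintro ⟨d, s⟩ y (rfl | rfl)
    · exact .rel _ _ (.edge d s)
    · cases s
      · refine .symm _ _ (.rel _ _ ?_)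
        have h := SignedRotationSystem.Adjacent.corner (ρ := ρ) (ρ.rot.symm d)
        rwa [Equiv.apply_symm_apply] at h
      · exact .rel _ _ (.corner d)

/-- The closed boundary walks of an untwisted rotation system are the cycles of the product of the
rotation and the edge involution: each walk, followed along its sides of one kind, is a cycle. -/
lemma RotationSystem.faceCount_eq (ρ : RotationSystem G) :
    ρ.faceCount = faceNum ρ.rot (fun _ => false) + G.isolatedCount := by
  rw [RotationSystem.faceCount, faceNum]
  congr 1
  set r := stepRel (edgeSide fun _ : E => false) (cornerSide ρ.rot)
  have hedge : ∀ x, Quot.mk r x = Quot.mk r (edgeSide _ x) := fun x => Quot.sound (Or.inl rfl)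
  have hcor : ∀ x, Quot.mk r x = Quot.mk r (cornerSide _ x) := fun x => Quot.sound (Or.inr rfl)
  have hstep : ∀ d, Quot.mk r ((ρ.rot * flip E) d, false) = Quot.mk r (d, false) := fun d =>
    ((hedge (d, false)).trans (hcor _)).symm
  have hcorner : ∀ d, (ρ.rot * flip E).SameCycle (ρ.rot d) (flip E d) := fun d => by
    have h : (ρ.rot * flip E) (flip E d) = ρ.rot d := by simp
    rw [← h]
    exact Equiv.Perm.sameCycle_apply_left.2 (.refl _ _)
  let g : (E × Bool) × Bool → Quotient (Equiv.Perm.SameCycle.setoid (ρ.rot * flip E)) := fun x =>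
    if x.2 then Quotient.mk _ (ρ.rot x.1) else Quotient.mk _ x.1
  have hg : ∀ x y, r x y → g x = g y := by
    rintro ⟨d, s⟩ y (rfl | rfl)
    · cases s
      · exact Quotient.sound (Equiv.Perm.sameCycle_apply_right.2 (.refl _ _))
      · exact Quotient.sound (hcorner d)
    · cases s
      · exact congrArg (Quotient.mk _) (Equiv.apply_symm_apply _ _).symm
      · rfl
  refine Nat.card_congr
    { toFun := Quotient.lift (fun d => Quot.mk r (d, false)) fun d d' h =>
        Equiv.Perm.SameCycle.apply_eq_of_invariant (f := fun d => Quot.mk r (d, false)) hstep h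
      invFun := Quot.lift g hg
      left_inv := by
        rintro ⟨d⟩
        rfl
      right_inv := ?_ }
  rintro ⟨d, _ | _⟩
  · rfl
  · exact (hcor (d, true)).symm

end FaceCount

/-! ### Disjoint unions -/

section Disjoint

variable {I J : Type*} {E : I → Type*}

/-- A dart of the part `i`, as a dart of the disjoint union of all parts and of further edges,
indexed by `J`. -/
def partDart (J : Type*) (i : I) (d : E i × Bool) : ((Σ i, E i) ⊕ J) × Bool :=
  (Sum.inl ⟨i, d.1⟩, d.2)

lemma partDart_injective (i : I) : Function.Injective (partDart (E := E) J i) := by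
  rintro ⟨e, b⟩ ⟨e', b'⟩ h
  simpa [partDart] using h

/-- The disjoint union of rotations of the parts, with the darts of the further edges fixed. -/
def unionPerm (J : Type*) (r : ∀ i, Equiv.Perm (E i × Bool)) :
    Equiv.Perm (((Σ i, E i) ⊕ J) × Bool) where
  toFun
    | (Sum.inl ⟨i, e⟩, b) => partDart J i (r i (e, b))
    | (Sum.inr j, b) => (Sum.inr j, b)
  invFun
    | (Sum.inl ⟨i, e⟩, b) => partDart J i ((r i).symm (e, b))
    | (Sum.inr j, b) => (Sum.inr j, b)
  left_inv := by rintro ⟨⟨i, e⟩ | j, b⟩ <;> simp [partDart]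
  right_inv := by rintro ⟨⟨i, e⟩ | j, b⟩ <;> simp [partDart]

variable (r : ∀ i, Equiv.Perm (E i × Bool))

@[simp] lemma unionPerm_partDart (i : I) (d : E i × Bool) :
    unionPerm J r (partDart J i d) = partDart J i (r i d) := rfl

@[simp] lemma unionPerm_inr (j : J) (b : Bool) :
    unionPerm J r (Sum.inr j, b) = (Sum.inr j, b) := rfl

lemma unionPerm_injective : Function.Injective (unionPerm (E := E) J) := fun r r' h => by
  ext1 i
  ext1 d
  have h' := congrArg (fun q : Equiv.Perm _ => q (partDart J i d)) h
  exact partDart_injective i h'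

/-- The faces of a disjoint union are the faces of its parts; every further edge has one face. -/
lemma faceNum_unionPerm [Fintype I] [Finite J] [∀ i, Finite (E i)]
    (tw : (Σ i, E i) ⊕ J → Bool) :
    faceNum (unionPerm J r) tw =
      ∑ i, faceNum (r i) (fun e => tw (Sum.inl ⟨i, e⟩)) + Nat.card J := by
  set R := stepRel (edgeSide tw) (cornerSide (unionPerm J r)) with hR
  set R' : ∀ i, _ → _ → Prop := fun i =>
    stepRel (edgeSide fun e => tw (Sum.inl ⟨i, e⟩)) (cornerSide (r i)) with hR'
  let f : (((Σ i, E i) ⊕ J) × Bool) × Bool → (Σ i, Quot (R' i)) ⊕ J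
    | ((Sum.inl ⟨i, e⟩, b), s) => Sum.inl ⟨i, Quot.mk _ ((e, b), s)⟩
    | ((Sum.inr j, _), _) => Sum.inr j
  have hf : ∀ x y, R x y → f x = f y := by
    rintro ⟨⟨⟨i, e⟩ | j, b⟩, s⟩ y (rfl | rfl)
    · exact congrArg Sum.inl (congrArg (Sigma.mk i) (Quot.sound (Or.inl rfl)))
    · cases s <;> exact congrArg Sum.inl (congrArg (Sigma.mk i) (Quot.sound (Or.inr rfl)))
    · rfl
    · cases s <;> rfl
  have hg : ∀ i x y, R' i x y →
      Quot.mk R (partDart J i x.1, x.2) = Quot.mk R (partDart J i y.1, y.2) := by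
    rintro i ⟨⟨e, b⟩, s⟩ y (rfl | rfl)
    · exact Quot.sound (Or.inl rfl)
    · cases s <;> exact Quot.sound (Or.inr rfl)
  have hcorner : ∀ j b, Quot.mk R ((Sum.inr j, b), true) = Quot.mk R ((Sum.inr j, b), false) :=
    fun j b => Quot.sound (Or.inr rfl)
  have hside : ∀ j b s, Quot.mk R ((Sum.inr j, b), s) = Quot.mk R ((Sum.inr j, b), false) :=
    fun j b s => by cases s; exacts [rfl, hcorner j b]
  have hend : ∀ j, Quot.mk R ((Sum.inr j, true), false) = Quot.mk R ((Sum.inr j, false), false) :=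
    fun j => by
      have h : Quot.mk R ((Sum.inr j, true), false) =
          Quot.mk R (edgeSide tw ((Sum.inr j, true), false)) := Quot.sound (Or.inl rfl)
      exact h.trans (hside j false _)
  have e : Quot R ≃ (Σ i, Quot (R' i)) ⊕ J :=
    { toFun := Quot.lift f hf
      invFun := Sum.elim
        (fun p => Quot.lift (fun x => Quot.mk R (partDart J p.1 x.1, x.2)) (hg p.1) p.2)
        (fun j => Quot.mk R ((Sum.inr j, false), false))
      left_inv := by
        rintro ⟨⟨⟨i, e⟩ | j, b⟩, s⟩
        · rfl
        · cases b
          · exact (hside j false s).symm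
          · exact ((hside j true s).trans (hend j)).symm
      right_inv := by
        rintro (⟨i, ⟨x⟩⟩ | j) <;> rfl }
  rw [faceNum, ← hR, Nat.card_congr e, Nat.card_sum, Nat.card_sigma]
  rfl

end Disjoint

/-! ### The rotation of the bar-ring -/

/-- The unique darts `inDart i` at `u i` and `outDart i` at `v i`. -/
structure EndDarts {V E : ℕ → Type*} (G : ∀ i, Multigraph (V i) (E i)) (u v : ∀ i, V i) where
  inDart : ∀ i, E i × Bool
  outDart : ∀ i, E i × Bool
  vert_eq_in_iff : ∀ i d, (G i).vert d = u i ↔ d = inDart i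
  vert_eq_out_iff : ∀ i d, (G i).vert d = v i ↔ d = outDart i
  in_ne_out : ∀ i, inDart i ≠ outDart i

lemma EndDarts.left_ne_right {V E : ℕ → Type*} {G : ∀ i, Multigraph (V i) (E i)}
    {u v : ∀ i, V i} (m : EndDarts G u v) (i : ℕ) : u i ≠ v i := fun h =>
  m.in_ne_out i ((m.vert_eq_out_iff i _).1 (((m.vert_eq_in_iff i _).2 rfl).trans h))

lemma IsPendant.exists_forall_vert_eq_iff {V E : Type*} {G : Multigraph V E} {w : V}
    (h : G.IsPendant w) : ∃ d₀, ∀ d, G.vert d = w ↔ d = d₀ := by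
  obtain ⟨h1, ⟨⟨d₀, hd₀⟩⟩⟩ := Nat.card_eq_one_iff_unique.1 h
  refine ⟨d₀, fun d => ⟨fun hd => ?_, fun hd => hd ▸ hd₀⟩⟩
  exact congrArg Subtype.val (h1.elim ⟨d, hd⟩ ⟨d₀, hd₀⟩)

lemma nonempty_endDarts {V E : ℕ → Type*} {G : ∀ i, Multigraph (V i) (E i)} {u v : ∀ i, V i}
    (huv : ∀ i, u i ≠ v i) (hu : ∀ i, (G i).IsPendant (u i)) (hv : ∀ i, (G i).IsPendant (v i)) :
    Nonempty (EndDarts G u v) := by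
  choose a ha using fun i => (hu i).exists_forall_vert_eq_iff
  choose b hb using fun i => (hv i).exists_forall_vert_eq_iff
  refine ⟨⟨a, b, ha, hb, fun i h => huv i ?_⟩⟩
  rw [← (ha i _).2 rfl, h, (hb i _).2 rfl]

variable {V E : ℕ → Type*} {G : ∀ i, Multigraph (V i) (E i)} {u v : ∀ i, V i}

/-- The darts of the bar-ring of `G 0, …, G n`. -/
abbrev RingDart (E : ℕ → Type*) (n : ℕ) := ((Σ i : Fin (n + 1), E i) ⊕ Fin (n + 1)) × Bool

/-- A dart of `G i`, as a dart of the bar-ring. -/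
abbrev ringDart {n : ℕ} (i : Fin (n + 1)) (d : E i × Bool) : RingDart E n :=
  partDart (E := fun i : Fin (n + 1) => E i) (Fin (n + 1)) i d

lemma ringDart_injective {n : ℕ} (i : Fin (n + 1)) :
    Function.Injective (ringDart (E := E) (n := n) i) :=
  partDart_injective (E := fun i : Fin (n + 1) => E i) i

@[elab_as_elim]
lemma RingDart.cases {n : ℕ} {motive : RingDart E n → Prop}
    (part : ∀ (i : Fin (n + 1)) (d : E i × Bool), motive (ringDart i d))
    (bar : ∀ (i : Fin (n + 1)) (b : Bool), motive (Sum.inr i, b)) (d : RingDart E n) :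
    motive d := by
  obtain ⟨⟨i, e⟩ | i, b⟩ := d
  exacts [part i (e, b), bar i b]

@[simp] lemma barRing_vert_ringDart {n : ℕ} (i : Fin (n + 1)) (d : E i × Bool) :
    (barRing G u v (n + 1)).vert (ringDart i d) = ⟨i, (G i).vert d⟩ := rfl

@[simp] lemma barRing_vert_inr_false {n : ℕ} (i : Fin (n + 1)) :
    (barRing G u v (n + 1)).vert (Sum.inr i, false) = ⟨i, v i⟩ := rfl

@[simp] lemma barRing_vert_inr_true {n : ℕ} (i : Fin (n + 1)) :
    (barRing G u v (n + 1)).vert (Sum.inr i, true) =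
      ⟨finRotate (n + 1) i, u (finRotate (n + 1) i)⟩ := rfl

namespace EndDarts

variable (m : EndDarts G u v) (n : ℕ)

@[simp] lemma vert_inDart (i : ℕ) : (G i).vert (m.inDart i) = u i := (m.vert_eq_in_iff i _).2 rfl

@[simp] lemma vert_outDart (i : ℕ) : (G i).vert (m.outDart i) = v i :=
  (m.vert_eq_out_iff i _).2 rfl

/-- Going around the ring one meets alternately the vertices `v i` and `u i`. At the `k`-th of
these vertices, `joinLeft k` is the first dart met and `joinRight k` is the second one. -/
def joinLeft (k : ℕ) : RingDart E n :=
  if Even k then ringDart (Fin.ofNat (n + 1) (k / 2)) (m.outDart _)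
  else (Sum.inr (Fin.ofNat (n + 1) (k / 2)), true)

/-- The second dart at the `k`-th vertex of degree two of the ring; see `joinLeft`. -/
def joinRight (k : ℕ) : RingDart E n :=
  if Even k then (Sum.inr (Fin.ofNat (n + 1) (k / 2)), false)
  else ringDart (finRotate (n + 1) (Fin.ofNat (n + 1) (k / 2))) (m.inDart _)

variable {n}

lemma ofNat_half_even (i : Fin (n + 1)) : Fin.ofNat (n + 1) (2 * i / 2) = i := by
  ext; simp

lemma ofNat_half_odd (i : Fin (n + 1)) : Fin.ofNat (n + 1) ((2 * i + 1) / 2) = i := by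
  have : (2 * (i : ℕ) + 1) / 2 = i := by omega
  rw [this]
  ext; simp

lemma joinLeft_even (i : Fin (n + 1)) : m.joinLeft n (2 * i) = ringDart i (m.outDart i) := by
  rw [joinLeft, if_pos (even_two_mul _), ofNat_half_even]

lemma joinLeft_odd (i : Fin (n + 1)) : m.joinLeft n (2 * i + 1) = (Sum.inr i, true) := by
  rw [joinLeft, if_neg (by simp), ofNat_half_odd]

lemma joinRight_even (i : Fin (n + 1)) : m.joinRight n (2 * i) = (Sum.inr i, false) := by
  rw [joinRight, if_pos (even_two_mul _), ofNat_half_even]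

lemma joinRight_odd (i : Fin (n + 1)) : m.joinRight n (2 * i + 1) =
    ringDart (finRotate (n + 1) i) (m.inDart (finRotate (n + 1) i)) := by
  rw [joinRight, if_neg (by simp), ofNat_half_odd]

lemma exists_eq_two_mul {k : ℕ} (hk : k < 2 * (n + 1)) :
    ∃ i : Fin (n + 1), k = 2 * i ∨ k = 2 * i + 1 :=
  ⟨⟨k / 2, by omega⟩, by simp only; omega⟩

/-- The position on the ring of an edge: `2 * i` for the edges of `G i`, and `2 * i + 1` for the
edge from `v i` onwards. -/
def level : (Σ i : Fin (n + 1), E i) ⊕ Fin (n + 1) → ℕ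
  | Sum.inl e => 2 * e.1
  | Sum.inr i => 2 * i + 1

@[simp] lemma level_ringDart (i : Fin (n + 1)) (d : E i × Bool) :
    level (ringDart i d).1 = 2 * i := rfl

@[simp] lemma level_inr (i : Fin (n + 1)) : level (E := E) (Sum.inr i) = 2 * i + 1 := rfl

lemma level_joinLeft {k : ℕ} (hk : k < 2 * (n + 1)) : level (m.joinLeft n k).1 = k := by
  obtain ⟨i, rfl | rfl⟩ := exists_eq_two_mul hk
  · rw [joinLeft_even, level_ringDart]
  · rw [joinLeft_odd, level_inr]

lemma level_joinRight {k : ℕ} (hk : k < 2 * n + 1) : level (m.joinRight n k).1 = k + 1 := by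
  obtain ⟨i, rfl | rfl⟩ := exists_eq_two_mul (n := n) (k := k) (by omega)
  · rw [joinRight_even, level_inr]
  · rw [joinRight_odd, level_ringDart, coe_finRotate_of_ne_last]
    · ring
    · rintro rfl
      simp at hk

lemma disjointPairs : DisjointPairs (m.joinLeft n) (m.joinRight n) (2 * (n + 1)) where
  left j hj k hk h := by rw [← m.level_joinLeft hj, h, m.level_joinLeft hk]
  right j hj k hk h := by
    have hl := congrArg (fun d : RingDart E n => level d.1) h
    obtain ⟨i, rfl | rfl⟩ := exists_eq_two_mul hj <;>
      obtain ⟨i', rfl | rfl⟩ := exists_eq_two_mul hk <;>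
      simp only [joinRight_even, joinRight_odd, level_inr, level_ringDart] at hl
    · omega
    · omega
    · omega
    · have h' : finRotate (n + 1) i = finRotate (n + 1) i' := Fin.ext (by omega)
      rw [(finRotate (n + 1)).injective h']
  left_ne_right j hj k hk h := by
    have hl := congrArg (fun d : RingDart E n => level d.1) h
    obtain ⟨i, rfl | rfl⟩ := exists_eq_two_mul hj <;>
      obtain ⟨i', rfl | rfl⟩ := exists_eq_two_mul hk <;>
      simp only [joinLeft_even, joinLeft_odd, joinRight_even, joinRight_odd, level_inr,
        level_ringDart] at h hl
    · omega
    · have hi : i = finRotate (n + 1) i' := Fin.ext (by omega)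
      rw [← hi] at h
      exact m.in_ne_out i (ringDart_injective i h).symm
    · simp at h
    · omega

variable (n) in
open Classical in
/-- The permutation that exchanges the two darts at every `u i` and at every `v i`. -/
noncomputable def joinPerm : Equiv.Perm (RingDart E n) :=
  swapProd (m.joinLeft n) (m.joinRight n) (2 * (n + 1))

@[simp] lemma joinPerm_outDart (i : Fin (n + 1)) :
    m.joinPerm n (ringDart i (m.outDart i)) = (Sum.inr i, false) := by
  classical
  rw [← joinLeft_even, ← joinRight_even]
  exact swapProd_apply_left m.disjointPairs (by omega)

@[simp] lemma joinPerm_inr_false (i : Fin (n + 1)) :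
    m.joinPerm n (Sum.inr i, false) = ringDart i (m.outDart i) := by
  classical
  rw [← joinLeft_even, ← m.joinRight_even]
  exact swapProd_apply_right m.disjointPairs (by omega)

@[simp] lemma joinPerm_inr_true (i : Fin (n + 1)) :
    m.joinPerm n (Sum.inr i, true) =
      ringDart (finRotate (n + 1) i) (m.inDart (finRotate (n + 1) i)) := by
  classical
  rw [← m.joinLeft_odd, ← joinRight_odd]
  exact swapProd_apply_left m.disjointPairs (by omega)

lemma joinPerm_inDart_finRotate (i : Fin (n + 1)) :
    m.joinPerm n (ringDart (finRotate (n + 1) i) (m.inDart (finRotate (n + 1) i))) =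
      (Sum.inr i, true) := by
  classical
  rw [← m.joinLeft_odd, ← joinRight_odd]
  exact swapProd_apply_right m.disjointPairs (by omega)

@[simp] lemma joinPerm_inDart (i : Fin (n + 1)) :
    m.joinPerm n (ringDart i (m.inDart i)) = (Sum.inr ((finRotate (n + 1)).symm i), true) := by
  have h := m.joinPerm_inDart_finRotate ((finRotate (n + 1)).symm i)
  rwa [Equiv.apply_symm_apply] at h

lemma joinPerm_ringDart_of_ne (i : Fin (n + 1)) {d : E i × Bool} (h1 : d ≠ m.inDart i)
    (h2 : d ≠ m.outDart i) : m.joinPerm n (ringDart i d) = ringDart i d := by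
  classical
  refine swapProd_apply_of_ne (fun k hk h => ?_) (fun k hk h => ?_)
  all_goals have hl := congrArg (fun d : RingDart E n => level d.1) h
  · obtain ⟨j, rfl | rfl⟩ := exists_eq_two_mul hk
    · simp only [joinLeft_even, level_ringDart] at h hl
      have : i = j := Fin.ext (by omega)
      subst this
      exact h2 (ringDart_injective i h)
    · simp only [joinLeft_odd, level_inr, level_ringDart] at hl
      omega
  · obtain ⟨j, rfl | rfl⟩ := exists_eq_two_mul hk
    · simp only [joinRight_even, level_inr, level_ringDart] at hl
      omega
    · simp only [joinRight_odd, level_ringDart] at h hl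
      have : i = finRotate (n + 1) j := Fin.ext (by omega)
      subst this
      exact h1 (ringDart_injective _ h)

@[simp] lemma vert_joinPerm (d : RingDart E n) :
    (barRing G u v (n + 1)).vert (m.joinPerm n d) = (barRing G u v (n + 1)).vert d := by
  induction d using RingDart.cases with
  | part i d =>
    by_cases h1 : d = m.inDart i
    · subst h1
      rw [joinPerm_inDart, barRing_vert_inr_true, barRing_vert_ringDart, Equiv.apply_symm_apply,
        vert_inDart]
    by_cases h2 : d = m.outDart i
    · subst h2; simp
    · rw [joinPerm_ringDart_of_ne m i h1 h2]
  | bar i b => cases b <;> simp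

/-- The face count of the ring: all but one of the `2 * (n + 1)` junctions merge two faces, so up to
an error of at most one the number of faces is determined by the numbers of faces of the parts. -/
lemma abs_faceNum_joinPerm_mul_sub_le [∀ i, Finite (E i)]
    (r : ∀ i : Fin (n + 1), Equiv.Perm (E i × Bool)) (hin : ∀ i, r i (m.inDart i) = m.inDart i)
    (hout : ∀ i, r i (m.outDart i) = m.outDart i)
    (tw : (Σ i : Fin (n + 1), E i) ⊕ Fin (n + 1) → Bool) :
    |(faceNum (m.joinPerm n * unionPerm (Fin (n + 1)) r) tw : ℤ) -
      (∑ i, (faceNum (r i) (fun e => tw (Sum.inl ⟨i, e⟩)) : ℤ) - n)| ≤ 1 := by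
  classical
  have hxr : ∀ k < 2 * (n + 1), unionPerm (Fin (n + 1)) r (m.joinLeft n k) = m.joinLeft n k := by
    intro k hk
    obtain ⟨i, rfl | rfl⟩ := exists_eq_two_mul hk
    · rw [joinLeft_even, unionPerm_partDart, hout]
    · rw [joinLeft_odd, unionPerm_inr]
  have hyr : ∀ k < 2 * (n + 1), unionPerm (Fin (n + 1)) r (m.joinRight n k) = m.joinRight n k := by
    intro k hk
    obtain ⟨i, rfl | rfl⟩ := exists_eq_two_mul hk
    · rw [joinRight_even, unionPerm_inr]
    · rw [joinRight_odd, unionPerm_partDart, hin]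
  have hpos : ∀ d, level (unionPerm (Fin (n + 1)) r d).1 = level d.1 := by
    rintro ⟨⟨i, e⟩ | j, b⟩ <;> rfl
  have hdisj := m.disjointPairs (n := n)
  have hlt : 2 * n + 1 < 2 * (n + 1) := by omega
  -- the single edges contribute `n + 1` faces, and the first `2 * n + 1` junctions merge faces
  have h1 := faceNum_swapProd_mul_add tw (hdisj.mono hlt.le) (fun k hk => hxr k (hk.trans hlt))
    (fun k hk => hyr k (hk.trans hlt)) hpos (fun k hk => m.level_joinLeft (hk.trans hlt))
    (fun k hk => m.level_joinRight hk)
  rw [faceNum_unionPerm, Nat.card_eq_fintype_card, Fintype.card_fin] at h1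
  set r' := swapProd (m.joinLeft n) (m.joinRight n) (2 * n + 1) * unionPerm (Fin (n + 1)) r with hr'
  have hxf : r' (m.joinLeft n (2 * n + 1)) = m.joinLeft n (2 * n + 1) := by
    rw [hr', Equiv.Perm.mul_apply, hxr _ hlt]
    exact swapProd_apply_of_ne
      (fun j hj h' => hj.ne (hdisj.left _ hlt j (hj.trans hlt) h').symm)
      (fun j hj => hdisj.left_ne_right _ hlt j (hj.trans hlt))
  have hyf : r' (m.joinRight n (2 * n + 1)) = m.joinRight n (2 * n + 1) := by
    rw [hr', Equiv.Perm.mul_apply, hyr _ hlt]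
    exact swapProd_apply_of_ne (fun j hj => (hdisj.left_ne_right j (hj.trans hlt) _ hlt).symm)
      (fun j hj h' => hj.ne (hdisj.right _ hlt j (hj.trans hlt) h').symm)
  -- the last junction closes the ring: it may merge faces, split a face, or keep the number of faces
  have h2 := abs_faceNum_swap_mul_sub_le tw hxf hyf
  have h3 : m.joinPerm n * unionPerm (Fin (n + 1)) r =
      Equiv.swap (m.joinLeft n (2 * n + 1)) (m.joinRight n (2 * n + 1)) * r' := by
    rw [hr', ← mul_assoc]
    rfl
  rw [h3]
  have h4 : (∑ i, (faceNum (r i) (fun e => tw (Sum.inl ⟨i, e⟩)) : ℤ)) - n = faceNum r' tw := by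
    have : ((∑ i, faceNum (r i) (fun e => tw (Sum.inl ⟨i, e⟩)) : ℕ) : ℤ) =
        ∑ i, (faceNum (r i) (fun e => tw (Sum.inl ⟨i, e⟩)) : ℤ) := by push_cast; rfl
    rw [← this]
    omega
  rw [h4]
  exact h2

end EndDarts

/-! ### Rotation systems of the bar-ring -/

section Finiteness

variable {V E : Type*} {G : Multigraph V E}

lemma RotationSystem.rot_injective :
    Function.Injective (RotationSystem.rot : RotationSystem G → Equiv.Perm (E × Bool)) := by
  rintro ⟨r, _⟩ ⟨r', _⟩ h
  cases h
  rfl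

lemma SignedRotationSystem.prod_injective :
    Function.Injective fun ρ : SignedRotationSystem G => (ρ.toRotationSystem, ρ.twist) := by
  rintro ⟨r, t⟩ ⟨r', t'⟩ h
  cases h
  rfl

lemma RotationSystem.vert_rot (ρ : RotationSystem G) (d : E × Bool) :
    G.vert (ρ.rot d) = G.vert d :=
  (ρ.sameCycle_iff _ _).1 (Equiv.Perm.sameCycle_apply_left.2 (.refl _ _))

lemma RotationSystem.rot_apply_of_unique (ρ : RotationSystem G) {d₀ : E × Bool} {w : V}
    (h : ∀ d, G.vert d = w ↔ d = d₀) : ρ.rot d₀ = d₀ :=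
  (h _).1 ((ρ.vert_rot d₀).trans ((h _).2 rfl))

/-- A rotation does not fix a dart if there are other darts at its vertex. -/
lemma RotationSystem.rot_ne_of_vert_eq (ρ : RotationSystem G) {d d' : E × Bool} (hne : d ≠ d')
    (h : G.vert d = G.vert d') : ρ.rot d ≠ d := fun hfix =>
  hne (((ρ.sameCycle_iff d d').2 h).eq_of_left hfix)

lemma card_dart : Nat.card (E × Bool) = 2 * Nat.card E := by
  rw [Nat.card_prod, Nat.card_eq_fintype_card (α := Bool), Fintype.card_bool, mul_comm]

variable [Finite E]

instance : Finite (RotationSystem G) :=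
  Finite.of_injective _ RotationSystem.rot_injective

instance : Finite (SignedRotationSystem G) :=
  Finite.of_injective _ SignedRotationSystem.prod_injective

lemma card_rotationSystem_le {M : ℕ} (hM : Nat.card E ≤ M) :
    Nat.card (RotationSystem G) ≤ (2 * M).factorial := by
  refine (Nat.card_le_card_of_injective _ RotationSystem.rot_injective).trans ?_
  rw [Nat.card_perm, card_dart]
  exact Nat.factorial_le (by omega)

lemma card_signedRotationSystem_le {M : ℕ} (hM : Nat.card E ≤ M) :
    Nat.card (SignedRotationSystem G) ≤ (2 * M).factorial * 2 ^ M := by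
  refine (Nat.card_le_card_of_injective _ SignedRotationSystem.prod_injective).trans ?_
  rw [Nat.card_prod, Nat.card_fun, Nat.card_eq_fintype_card (α := Bool), Fintype.card_bool]
  exact Nat.mul_le_mul (card_rotationSystem_le hM) (Nat.pow_le_pow_right (by norm_num) hM)

lemma faceNum_le {M : ℕ} (hM : Nat.card E ≤ M) (r : Equiv.Perm (E × Bool)) (tw : E → Bool) :
    faceNum r tw ≤ 4 * M := by
  refine (Nat.card_le_card_of_surjective _ Quot.mk_surjective).trans ?_
  rw [Nat.card_prod, card_dart, Nat.card_eq_fintype_card (α := Bool), Fintype.card_bool]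
  omega

/-- Every multigraph has a rotation system: choose a cyclic order of the darts at each vertex. -/
instance : Nonempty (RotationSystem G) := by
  classical
  have := Fintype.ofFinite E
  choose c hc _ using fun w : V =>
    (Finset.univ.filter fun d : E × Bool => G.vert d = w).exists_cycleOn
  have hmaps : ∀ w d, G.vert d = w → G.vert (c w d) = w := fun w d hd => by
    simpa using (hc w).1.mapsTo (by simpa using hd : d ∈ _)
  let f : E × Bool → E × Bool := fun d => c (G.vert d) d
  have hf : Function.Injective f := fun d d' h => by
    have hv : G.vert d = G.vert d' := by
      rw [← hmaps _ d rfl, ← hmaps _ d' rfl]; exact congrArg G.vert h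
    simp only [f, hv] at h
    exact (c (G.vert d')).injective h
  let r : Equiv.Perm (E × Bool) := Equiv.ofBijective f (Finite.injective_iff_bijective.1 hf)
  have hr : ∀ d, r d = c (G.vert d) d := fun d => rfl
  refine ⟨⟨r, fun d d' => ⟨fun h => h.apply_eq_of_invariant fun d => hmaps _ d rfl, fun h => ?_⟩⟩⟩
  have hcyc : (c (G.vert d)).SameCycle d d' := (hc (G.vert d)).2 (by simp) (by simp [h])
  have hS := hcyc.mem_of_forall_apply_mem
    (S := {z | G.vert z = G.vert d ∧ r.SameCycle d z}) (by
      rintro z ⟨hz, hz'⟩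
      refine ⟨hmaps _ z hz, ?_⟩
      rw [← hz, ← hr]
      exact Equiv.Perm.sameCycle_apply_right.2 hz') ⟨rfl, .refl _ _⟩
  exact hS.2

instance : Nonempty (SignedRotationSystem G) :=
  ⟨⟨Classical.arbitrary _, fun _ => false⟩⟩

end Finiteness

namespace EndDarts

variable (m : EndDarts G u v) {n : ℕ}

lemma rot_inDart {i : ℕ} (ρ : RotationSystem (G i)) : ρ.rot (m.inDart i) = m.inDart i :=
  ρ.rot_apply_of_unique (m.vert_eq_in_iff i)

lemma rot_outDart {i : ℕ} (ρ : RotationSystem (G i)) : ρ.rot (m.outDart i) = m.outDart i :=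
  ρ.rot_apply_of_unique (m.vert_eq_out_iff i)

/-- The rotation of the bar-ring composed of rotations of the parts. -/
noncomputable def ringRot (ρ : ∀ i : Fin (n + 1), RotationSystem (G i)) :
    Equiv.Perm (RingDart E n) :=
  m.joinPerm n * unionPerm (Fin (n + 1)) fun i => (ρ i).rot

lemma ringRot_apply (ρ : ∀ i : Fin (n + 1), RotationSystem (G i)) (d : RingDart E n) :
    m.ringRot ρ d = m.joinPerm n (unionPerm (Fin (n + 1)) (fun i => (ρ i).rot) d) := rfl

lemma vert_ringRot (ρ : ∀ i : Fin (n + 1), RotationSystem (G i)) (d : RingDart E n) :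
    (barRing G u v (n + 1)).vert (m.ringRot ρ d) = (barRing G u v (n + 1)).vert d := by
  rw [ringRot_apply, vert_joinPerm]
  induction d using RingDart.cases with
  | part i d => rw [unionPerm_partDart, barRing_vert_ringDart, (ρ i).vert_rot]; rfl
  | bar i b => rw [unionPerm_inr]

lemma sameCycle_ringRot_ringDart (ρ : ∀ i : Fin (n + 1), RotationSystem (G i)) (i : Fin (n + 1))
    {d d' : E i × Bool} (h : (G i).vert d = (G i).vert d') :
    (m.ringRot ρ).SameCycle (ringDart i d) (ringDart i d') := by
  have hstep : ∀ z, (m.ringRot ρ).SameCycle (ringDart i z) (ringDart i ((ρ i).rot z)) := fun z => by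
    by_cases h1 : z = m.inDart i
    · rw [h1, rot_inDart]
    by_cases h2 : z = m.outDart i
    · rw [h2, rot_outDart]
    have h3 : m.ringRot ρ (ringDart i z) = ringDart i ((ρ i).rot z) := by
      rw [ringRot_apply, unionPerm_partDart]
      refine m.joinPerm_ringDart_of_ne i (fun h => h1 ?_) (fun h => h2 ?_)
      · exact (ρ i).rot.injective (h.trans (m.rot_inDart _).symm)
      · exact (ρ i).rot.injective (h.trans (m.rot_outDart _).symm)
    rw [← h3]
    exact Equiv.Perm.sameCycle_apply_right.2 (.refl _ _)
  have hcyc := ((ρ i).sameCycle_iff d d').2 h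
  exact Quotient.exact (s := Equiv.Perm.SameCycle.setoid (m.ringRot ρ))
    (hcyc.apply_eq_of_invariant (f := fun z =>
      Quotient.mk (Equiv.Perm.SameCycle.setoid (m.ringRot ρ)) (ringDart i z))
      fun z => Quotient.sound (hstep z).symm)

lemma exists_sameCycle_ringRot (ρ : ∀ i : Fin (n + 1), RotationSystem (G i)) (d : RingDart E n) :
    ∃ (i : Fin (n + 1)) (z : E i × Bool), (m.ringRot ρ).SameCycle d (ringDart i z) := by
  induction d using RingDart.cases with
  | part i z => exact ⟨i, z, .refl _ _⟩
  | bar i b =>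
    cases b
    · refine ⟨i, m.outDart i, ?_⟩
      rw [← joinPerm_inr_false, ← unionPerm_inr (fun i => (ρ i).rot) i false]
      exact Equiv.Perm.sameCycle_apply_right.2 (.refl _ _)
    · refine ⟨finRotate (n + 1) i, m.inDart _, ?_⟩
      rw [← joinPerm_inr_true, ← unionPerm_inr (fun i => (ρ i).rot) i true]
      exact Equiv.Perm.sameCycle_apply_right.2 (.refl _ _)

/-- The rotation system of the bar-ring composed of rotation systems of the parts. -/
noncomputable def ringSystem (ρ : ∀ i : Fin (n + 1), RotationSystem (G i)) :
    RotationSystem (barRing G u v (n + 1)) where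
  rot := m.ringRot ρ
  sameCycle_iff d d' := by
    refine ⟨fun h => h.apply_eq_of_invariant (m.vert_ringRot ρ), fun h => ?_⟩
    obtain ⟨i, z, hz⟩ := m.exists_sameCycle_ringRot ρ d
    obtain ⟨i', z', hz'⟩ := m.exists_sameCycle_ringRot ρ d'
    rw [hz.apply_eq_of_invariant (m.vert_ringRot ρ), hz'.apply_eq_of_invariant (m.vert_ringRot ρ),
      barRing_vert_ringDart, barRing_vert_ringDart] at h
    obtain rfl : i = i' := congrArg Sigma.fst h
    exact (hz.trans (m.sameCycle_ringRot_ringDart ρ i (by simpa using h))).trans hz'.symm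

lemma ringSystem_injective : Function.Injective (m.ringSystem (n := n)) := fun ρ ρ' h => by
  have h1 := mul_left_cancel (congrArg RotationSystem.rot h)
  have h2 := unionPerm_injective h1
  ext1 i
  exact RotationSystem.rot_injective (congrFun h2 i)

/-! The rotation at a vertex of degree two is unique, so every rotation system of the bar-ring
arises in this way. -/

lemma eq_or_eq_of_vert_eq_out {i : Fin (n + 1)} {w : RingDart E n}
    (h : (barRing G u v (n + 1)).vert w = ⟨i, v i⟩) :
    w = ringDart i (m.outDart i) ∨ w = (Sum.inr i, false) := by
  induction w using RingDart.cases with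
  | part j z =>
    rw [barRing_vert_ringDart] at h
    obtain rfl : j = i := congrArg Sigma.fst h
    exact Or.inl (congrArg _ ((m.vert_eq_out_iff j z).1 (by simpa using h)))
  | bar j b =>
    cases b
    · rw [barRing_vert_inr_false] at h
      obtain rfl : j = i := congrArg Sigma.fst h
      exact Or.inr rfl
    · rw [barRing_vert_inr_true] at h
      obtain rfl : finRotate (n + 1) j = i := congrArg Sigma.fst h
      exact absurd (by simpa using h) (m.left_ne_right _)

lemma eq_or_eq_of_vert_eq_in {i : Fin (n + 1)} {w : RingDart E n}
    (h : (barRing G u v (n + 1)).vert w = ⟨i, u i⟩) :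
    w = ringDart i (m.inDart i) ∨ w = (Sum.inr ((finRotate (n + 1)).symm i), true) := by
  induction w using RingDart.cases with
  | part j z =>
    rw [barRing_vert_ringDart] at h
    obtain rfl : j = i := congrArg Sigma.fst h
    exact Or.inl (congrArg _ ((m.vert_eq_in_iff j z).1 (by simpa using h)))
  | bar j b =>
    cases b
    · rw [barRing_vert_inr_false] at h
      obtain rfl : j = i := congrArg Sigma.fst h
      exact absurd (by simpa using h) (m.left_ne_right _).symm
    · rw [barRing_vert_inr_true] at h
      obtain rfl : finRotate (n + 1) j = i := congrArg Sigma.fst h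
      exact Or.inr (by rw [Equiv.symm_apply_apply])

lemma joinPerm_inr_ne (i : Fin (n + 1)) (b : Bool) :
    m.joinPerm n (Sum.inr i, b) ≠ (Sum.inr i, b) := by
  cases b <;> simp [partDart]

/-- The darts moved by `joinPerm` are those at vertices of degree two. -/
lemma eq_or_eq_joinPerm {d w : RingDart E n} (hd : m.joinPerm n d ≠ d)
    (h : (barRing G u v (n + 1)).vert w = (barRing G u v (n + 1)).vert d) :
    w = d ∨ w = m.joinPerm n d := by
  induction d using RingDart.cases with
  | part i z =>
    by_cases h1 : z = m.inDart i
    · subst h1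
      rw [joinPerm_inDart]
      exact m.eq_or_eq_of_vert_eq_in (by simpa using h)
    by_cases h2 : z = m.outDart i
    · subst h2
      rw [joinPerm_outDart]
      exact m.eq_or_eq_of_vert_eq_out (by simpa using h)
    · exact absurd (m.joinPerm_ringDart_of_ne i h1 h2) hd
  | bar i b =>
    cases b
    · rw [joinPerm_inr_false]
      exact (m.eq_or_eq_of_vert_eq_out h).symm
    · rw [joinPerm_inr_true]
      have h' := (m.eq_or_eq_of_vert_eq_in h).symm
      rwa [Equiv.symm_apply_apply] at h'

lemma rot_eq_joinPerm (R : RotationSystem (barRing G u v (n + 1))) {d : RingDart E n}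
    (hd : m.joinPerm n d ≠ d) : R.rot d = m.joinPerm n d :=
  (m.eq_or_eq_joinPerm hd (R.vert_rot d)).resolve_left
    (R.rot_ne_of_vert_eq hd.symm (m.vert_joinPerm d).symm)

variable [∀ i, Finite (E i)]

lemma ringSystem_surjective : Function.Surjective (m.ringSystem (n := n)) := by
  intro R
  set Q : Equiv.Perm (RingDart E n) := (m.joinPerm n)⁻¹ * R.rot with hQ
  have hRQ : ∀ d, R.rot d = m.joinPerm n (Q d) := fun d =>
    (Equiv.apply_symm_apply (m.joinPerm n) (R.rot d)).symm
  have hfix : ∀ d, m.joinPerm n d ≠ d → Q d = d := fun d hd =>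
    (m.joinPerm n).injective ((hRQ d).symm.trans (m.rot_eq_joinPerm R hd))
  have hvert : ∀ d, (barRing G u v (n + 1)).vert (Q d) = (barRing G u v (n + 1)).vert d :=
    fun d => by rw [← m.vert_joinPerm, ← hRQ, R.vert_rot]
  have hpart : ∀ (i : Fin (n + 1)) (d : E i × Bool), ∃ d', Q (ringDart i d) = ringDart i d' := by
    intro i d
    have hv := hvert (ringDart i d)
    generalize hw : Q (ringDart i d) = w at hv
    induction w using RingDart.cases with
    | part j z =>
      rw [barRing_vert_ringDart, barRing_vert_ringDart] at hv
      obtain rfl : j = i := congrArg Sigma.fst hv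
      exact ⟨z, rfl⟩
    | bar j b =>
      have h := Q.injective (hw.trans (hfix _ (m.joinPerm_inr_ne j b)).symm)
      simp [partDart] at h
  choose q hq using hpart
  have hqinj : ∀ i, Function.Injective (q i) := fun i d d' h =>
    ringDart_injective i (Q.injective (by rw [hq, hq, h]))
  let r : ∀ i : Fin (n + 1), Equiv.Perm (E i × Bool) := fun i =>
    Equiv.ofBijective (q i) (Finite.injective_iff_bijective.1 (hqinj i))
  have hr : ∀ i d, Q (ringDart i d) = ringDart i (r i d) := hq
  have hrvert : ∀ (i : Fin (n + 1)) (d : E i × Bool),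
      (G i).vert (r i d) = (G i).vert d := fun i d => by
    have h := hvert (ringDart i d)
    rw [hr, barRing_vert_ringDart, barRing_vert_ringDart] at h
    simpa using h
  have hcyc : ∀ (i : Fin (n + 1)) (d d' : E i × Bool), (G i).vert d = (G i).vert d' →
      (r i).SameCycle d d' := by
    intro i d d' h
    by_cases h1 : (G i).vert d = u i
    · rw [(m.vert_eq_in_iff i d).1 h1, (m.vert_eq_in_iff i d').1 (h ▸ h1)]
    by_cases h2 : (G i).vert d = v i
    · rw [(m.vert_eq_out_iff i d).1 h2, (m.vert_eq_out_iff i d').1 (h ▸ h2)]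
    have hR : R.rot.SameCycle (ringDart i d) (ringDart i d') :=
      (R.sameCycle_iff _ _).2 (by rw [barRing_vert_ringDart, barRing_vert_ringDart, h])
    -- away from the vertices of degree two, `R` stays within the part and acts there as `r i`
    have hmem := hR.mem_of_forall_apply_mem
      (S := {w | ∃ z, w = ringDart i z ∧ (G i).vert z = (G i).vert d ∧ (r i).SameCycle d z}) (by
        rintro _ ⟨z, rfl, hz, hz'⟩
        refine ⟨r i z, ?_, (hrvert i z).trans hz, Equiv.Perm.sameCycle_apply_right.2 hz'⟩
        rw [hRQ, hr]
        refine m.joinPerm_ringDart_of_ne i (fun h' => h1 ?_) fun h' => h2 ?_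
        · rw [← hz, ← hrvert, h', vert_inDart]
        · rw [← hz, ← hrvert, h', vert_outDart])
      ⟨d, rfl, rfl, .refl _ _⟩
    obtain ⟨z, hz, _, hz'⟩ := hmem
    rwa [ringDart_injective i hz]
  refine ⟨fun i => ⟨r i, fun d d' =>
    ⟨fun h => h.apply_eq_of_invariant (hrvert i), hcyc i d d'⟩⟩, ?_⟩
  refine RotationSystem.rot_injective (Equiv.ext fun d => ?_)
  change m.joinPerm n (unionPerm (Fin (n + 1)) r d) = R.rot d
  rw [hRQ]
  congr 1
  induction d using RingDart.cases with
  | part i d => exact (hr i d).symm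
  | bar i b => exact (hfix _ (m.joinPerm_inr_ne i b)).symm

variable (n) in
/-- Rotation systems of the bar-ring are families of rotation systems of the parts. -/
noncomputable def ringEquiv :
    RotationSystem (barRing G u v (n + 1)) ≃ ∀ i : Fin (n + 1), RotationSystem (G i) :=
  (Equiv.ofBijective m.ringSystem ⟨m.ringSystem_injective, m.ringSystem_surjective⟩).symm

lemma rot_eq_of_ringEquiv (R : RotationSystem (barRing G u v (n + 1))) :
    R.rot = m.joinPerm n * unionPerm (Fin (n + 1)) fun i => (m.ringEquiv n R i).rot := by
  conv_lhs => rw [← (m.ringEquiv n).symm_apply_apply R]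
  rfl

variable (n) in
/-- Signed rotation systems of the bar-ring are families of signed rotation systems of the parts,
each together with the twist of the edge of the ring that follows the part. -/
noncomputable def signedRingEquiv :
    SignedRotationSystem (barRing G u v (n + 1)) ≃
      ∀ i : Fin (n + 1), SignedRotationSystem (G i) × Bool where
  toFun R i := (⟨m.ringEquiv n R.toRotationSystem i, fun e => R.twist (Sum.inl ⟨i, e⟩)⟩,
    R.twist (Sum.inr i))
  invFun ρ := ⟨(m.ringEquiv n).symm fun i => (ρ i).1.toRotationSystem,
    Sum.elim (fun e => (ρ e.1).1.twist e.2) fun i => (ρ i).2⟩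
  left_inv R := by
    refine SignedRotationSystem.prod_injective (Prod.ext ?_ ?_)
    · exact (m.ringEquiv n).symm_apply_apply _
    · ext (e | i) <;> rfl
  right_inv ρ := by
    ext1 i
    refine Prod.ext (SignedRotationSystem.prod_injective (Prod.ext ?_ ?_)) rfl
    · exact congrFun ((m.ringEquiv n).apply_symm_apply _) i
    · rfl

/-- The number of faces of an embedding of the bar-ring, in terms of the parts. -/
lemma abs_faceNum_ring_sub_le (R : RotationSystem (barRing G u v (n + 1)))
    (tw : (Σ i : Fin (n + 1), E i) ⊕ Fin (n + 1) → Bool) :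
    |(faceNum R.rot tw : ℤ) - (∑ i : Fin (n + 1),
      (faceNum (m.ringEquiv n R i).rot (fun e => tw (Sum.inl ⟨i, e⟩)) : ℤ) - n)| ≤ 1 := by
  rw [m.rot_eq_of_ringEquiv R]
  exact m.abs_faceNum_joinPerm_mul_sub_le _ (fun i => m.rot_inDart _) (fun i => m.rot_outDart _) tw

end EndDarts

/-! ### Asymptotic normality -/

/-- If the range of genera has at least two elements, then there are two rotation systems with
different numbers of faces. -/
lemma exists_faceNum_ne_of_minGenus_lt {V E : Type*} [Finite E] {G : Multigraph V E}
    (h : G.minGenus < G.maxGenus) :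
    ∃ ρ ρ' : RotationSystem G,
      faceNum ρ.rot (fun _ => false) + 1 ≤ faceNum ρ'.rot (fun _ => false) := by
  set S := {i | 0 < G.genusDistribution i} with hS
  have hSmem : ∀ i ∈ S, ∃ ρ : RotationSystem G, ρ.eulerGenus = 2 * (i : ℤ) := fun i hi => by
    obtain ⟨⟨ρ, hρ⟩⟩ := (Nat.card_pos_iff.1 (show 0 < Nat.card _ from hi)).1
    exact ⟨ρ, hρ⟩
  have hne : S.Nonempty := by
    by_contra hne
    rw [Set.not_nonempty_iff_eq_empty] at hne
    rw [minGenus, maxGenus, ← hS, hne] at h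
    simp at h
  have hfin : S.Finite := by
    refine (Set.finite_range fun ρ : RotationSystem G => (ρ.eulerGenus / 2).toNat).subset ?_
    intro i hi
    obtain ⟨ρ, hρ⟩ := hSmem i hi
    exact ⟨ρ, by simp only; omega⟩
  obtain ⟨ρ, hρ⟩ := hSmem _ (Nat.sInf_mem hne)
  obtain ⟨ρ', hρ'⟩ := hSmem _ (Nat.sSup_mem hne hfin.bddAbove)
  refine ⟨ρ', ρ, ?_⟩
  change ρ.eulerGenus = 2 * (G.minGenus : ℤ) at hρ
  change ρ'.eulerGenus = 2 * (G.maxGenus : ℤ) at hρ'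
  rw [RotationSystem.eulerGenus, RotationSystem.faceCount_eq] at hρ hρ'
  omega

instance {V E : Type*} (G : Multigraph V E) : DiscreteMeasurableSpace (RotationSystem G) :=
  ⟨fun _ => trivial⟩

instance {V E : Type*} (G : Multigraph V E) : DiscreteMeasurableSpace (SignedRotationSystem G) :=
  ⟨fun _ => trivial⟩

end Multigraph

theorem mainTheorem1 {V E : ℕ → Type*} [∀ i, Finite (V i)] [∀ i, Finite (E i)]
    (G : ∀ i, Multigraph (V i) (E i)) (u v : ∀ i, V i)
    (huv : ∀ i, u i ≠ v i)
    (hu : ∀ i, (G i).IsPendant (u i)) (hv : ∀ i, (G i).IsPendant (v i))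
    (hconn : ∀ i, (G i).Connected)
    (hgenus : {i | (G i).minGenus < (G i).maxGenus}.Infinite)
    (M : ℕ) (hM : ∀ i, Nat.card (E i) ≤ M) :
    Multigraph.GenusAsymptoticallyNormal (fun n => Multigraph.barRing G u v (n + 1)) ∧
      Multigraph.EulerGenusAsymptoticallyNormal
        (fun n => Multigraph.barRing G u v (n + 1)) := by
  obtain ⟨m⟩ := Multigraph.nonempty_endDarts huv hu hv
  have hbound : ∀ i (r : Equiv.Perm (E i × Bool)) tw,
      ((Multigraph.faceNum r tw : ℕ) : ℝ) ≤ 4 * M := fun i r tw => by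
    exact_mod_cast Multigraph.faceNum_le (hM i) r tw
  -- the Euler-genus is a constant minus the number of faces
  set c : ℕ → ℝ := fun n => 2 - ((Nat.card (Σ i : Fin (n + 1), V i) : ℝ) -
    Nat.card ((Σ i : Fin (n + 1), E i) ⊕ Fin (n + 1)) +
    ((Multigraph.barRing G u v (n + 1)).isolatedCount - n)) with hc
  constructor
  · refine asymptoticallyNormal_uniformOn (fun i => Multigraph.card_rotationSystem_le (hM i))
      (fun i (ρ : (G i).RotationSystem) => -(Multigraph.faceNum ρ.rot fun _ => false : ℝ) / 2)
      (B := 4 * M) (fun i ρ => ?_) (g := 1 / 2) (by norm_num) (hgenus.mono fun i hi => ?_)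
      (fun n => m.ringEquiv n) _ (fun n => c n / 2) (C := 1) fun n R => ?_
    · have h := hbound i ρ.rot fun _ => false
      have h0 : (0 : ℝ) ≤ Multigraph.faceNum ρ.rot fun _ => false := Nat.cast_nonneg _
      rw [abs_le]
      constructor <;> linarith
    · obtain ⟨ρ, ρ', h⟩ := Multigraph.exists_faceNum_ne_of_minGenus_lt hi
      refine ⟨ρ, ρ', ?_⟩
      have h' : (Multigraph.faceNum ρ.rot (fun _ => false) + 1 : ℝ) ≤
        Multigraph.faceNum ρ'.rot (fun _ => false) := by exact_mod_cast h
      linarith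
    · have h := m.abs_faceNum_ring_sub_le R fun _ => false
      rw [← Int.cast_le (R := ℝ)] at h
      push_cast at h
      rw [Multigraph.RotationSystem.genus, Multigraph.RotationSystem.eulerGenus,
        Multigraph.RotationSystem.faceCount_eq]
      push_cast
      rw [← Finset.sum_div, Finset.sum_neg_distrib]
      rw [abs_le] at h ⊢
      simp only [hc]
      constructor <;> linarith [h.1, h.2]
  · refine asymptoticallyNormal_uniformOn (A := fun i => (G i).SignedRotationSystem × Bool)
      (K := (2 * M).factorial * 2 ^ M * 2) (fun i => ?_)
      (fun i ρ => -(Multigraph.faceNum ρ.1.rot ρ.1.twist : ℝ))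
      (B := 4 * M) (fun i ρ => ?_) (g := 1) one_pos (hgenus.mono fun i hi => ?_)
      (fun n => m.signedRingEquiv n) _ c (C := 1) fun n R => ?_
    · rw [Nat.card_prod, Nat.card_eq_fintype_card (α := Bool), Fintype.card_bool]
      exact Nat.mul_le_mul_right 2 (Multigraph.card_signedRotationSystem_le (hM i))
    · have h := hbound i ρ.1.rot ρ.1.twist
      have h0 : (0 : ℝ) ≤ Multigraph.faceNum ρ.1.rot ρ.1.twist := Nat.cast_nonneg _
      rw [abs_le]
      constructor <;> linarith
    · obtain ⟨ρ, ρ', h⟩ := Multigraph.exists_faceNum_ne_of_minGenus_lt hi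
      refine ⟨(⟨ρ, fun _ => false⟩, false), (⟨ρ', fun _ => false⟩, false), ?_⟩
      have h' : (Multigraph.faceNum ρ.rot (fun _ => false) + 1 : ℝ) ≤
        Multigraph.faceNum ρ'.rot (fun _ => false) := by exact_mod_cast h
      simp only
      linarith
    · have h := m.abs_faceNum_ring_sub_le R.toRotationSystem R.twist
      rw [← Int.cast_le (R := ℝ)] at h
      push_cast at h
      rw [Multigraph.SignedRotationSystem.eulerGenus, Multigraph.SignedRotationSystem.faceCount_eq]
      push_cast
      rw [Finset.sum_neg_distrib]
      rw [abs_le] at h ⊢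
      simp only [hc, Multigraph.EndDarts.signedRingEquiv, Equiv.coe_fn_mk]
      constructor <;> linarith [h.1, h.2]
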